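/- Fix a $2$-adic valuation on $\mathbb{R}$, that is, a function $|\cdot|_2\colon\mathbb{R}\to\mathbb{R}_{\ge 0}$ with $|x|_2=0\iff x=0$, $|xy|_2=|x|_2|y|_2$ and $|x+y|_2\le\max\{|x|_2,|y|_2\}$ that extends the $2$-adic absolute value of $\mathbb{Q}$ (so $|2^a r/s|_2=2^{-a}$ for $a \in \mathbb{Z}$ and odd integers $r,s$). Color a point $(x,y)\in\mathbb{R}^2$ red, green or blue according to whether the first, second or third entry of $(|x|_2,|y|_2,1)$ is the first one equal to $\max\{|x|_2,|y|_2,1\}$. A line segment is red-blue if one of its endpoints is red and the other is blue. Let $P\subset\mathbb{R}^2$ be a simple polygon, i.e. the compact region bounded by a simple closed curve formed by finitely many line segments; its sides are the maximal line segments on its boundary and its corners are the endpoints of its sides. Let $D=\{t_1,\dots,t_n\}$ be a dissection of $P$, i.e. a finite set of (nondegenerate, closed) triangles with pairwise disjoint interiors and union $P$. Let $V$ be the set of all corners of the triangles of $D$ (the nodes of the skeleton graph of $D$). A constrained framed map is a map $\phi\colon V\to\mathbb{R}^2$ such that $\phi(c)=c$ for every corner $c$ of $P$ and such that, for every segment $s$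 that is a side of some $t_i$ or a side of $P$, the points $\phi(v)$ with $v\in V\cap s$ lie on a common line. The unsigned area of the triangular face $t_i$ with corners $c_1,c_2,c_3$ with respect to $\phi$ is $$|a_\phi(t_i)|=\left|\frac12\det\begin{pmatrix}1&1&1\\ x_{\phi(c_1)}&x_{\phi(c_2)}&x_{\phi(c_3)}\\ y_{\phi(c_1)}&y_{\phi(c_2)}&y_{\phi(c_3)}\end{pmatrix}\right|,$$ where $(x_{\phi(c_j)},y_{\phi(c_j)})$ are the coordinates of $\phi(c_j)$. Suppose that the area of $P$ is an integer, that $P$ has an odd number of red-blue sides, and that the number $n$ of triangles of $D$ is odd. Let $\phi$ be a constrained framed map of the skeleton graph of $D$. Then the triangular faces do not all have the same unsigned area with respect to $\phi$; that is, there is no $\alpha\in\mathbb{R}$ with $|a_\phi(t_i)|=\alpha$ for all $i=1,\dots,n$. -/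

import Mathlib

open MeasureTheory

noncomputable section

/-- The Euclidean plane `ℝ²`. -/
abbrev Plane : Type := EuclideanSpace ℝ (Fin 2)

/-! ### Simple polygons -/

/-- A simple `k`-gon: a compact planar region together with the cyclic sequence of its corners.
The boundary of the region is the closed polygonal curve through the corners; this curve is
simple, and no three consecutive corners are collinear, so that the edges of the curve are exactly
the maximal line segments on the boundary. -/
structure SimplePolygon (k : ℕ) [NeZero k] where
  /-- the polygon as a subset of the plane -/
  carrier : Set Plane
  /-- the corners in cyclic order -/
  corners : Polygon Plane k
  isCompact : IsCompact carrier
  /-- the polygon is the region enclosed by the curve, not the bare curve -/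
  interior_nonempty : (interior carrier).Nonempty
  frontier_eq : frontier carrier = corners.boundary ℝ
  /-- the closed curve obtained by running through the half-open edges one after the other
  does not meet itself -/
  simple : Function.Injective
    (fun p : Fin k × Set.Ico (0 : ℝ) 1 => corners.edgePath ℝ p.1 (p.2 : ℝ))
  nondegenerate : corners.HasNondegenerateVertices ℝ

namespace SimplePolygon

variable {k : ℕ} [NeZero k]

/-- The `i`-th side: the segment from the `i`-th corner to the cyclically next one. -/
def side (P : SimplePolygon k) (i : Fin k) : Set Plane := P.corners.edgeSet ℝ i

end SimplePolygon

/-! ### Dissections and their skeleton graphs -/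

/-- A dissection of the simple polygon `P` into `n` (closed, nondegenerate) triangles with
pairwise disjoint interiors whose union is `P`. -/
structure Dissection {k : ℕ} [NeZero k] (P : SimplePolygon k) (n : ℕ) where
  tri : Fin n → Affine.Triangle ℝ Plane
  disjoint_interiors : ∀ i j : Fin n, i ≠ j →
    Disjoint (interior (convexHull ℝ (Set.range (tri i).points)))
      (interior (convexHull ℝ (Set.range (tri j).points)))
  iUnion_eq : ⋃ i, convexHull ℝ (Set.range (tri i).points) = P.carrier

namespace Dissection

variable {k : ℕ} [NeZero k] {P : SimplePolygon k} {n : ℕ}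

/-- The set of nodes of the skeleton graph: all corners of the triangles. -/
def nodes (D : Dissection P n) : Set Plane := ⋃ i, Set.range (D.tri i).points

/-- The vertex type of the skeleton graph. -/
abbrev Node (D : Dissection P n) : Type := {p : Plane // p ∈ D.nodes}

/-- The `j`-th corner of the `i`-th triangle, as a node. -/
def corner (D : Dissection P n) (i : Fin n) (j : Fin 3) : D.Node :=
  ⟨(D.tri i).points j, Set.mem_iUnion.mpr ⟨i, Set.mem_range_self j⟩⟩

/-- The side of the `i`-th triangle joining its `j`-th and `j'`-th corners (for `j ≠ j'`). -/
def triSide (D : Dissection P n) (i : Fin n) (j j' : Fin 3) : Set Plane :=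
  segment ℝ ((D.tri i).points j) ((D.tri i).points j')

/-- The nodes lying on a subset `S` of the plane. If `S` is a side of a triangle, or a side of
`P`, these are the two corners and the side nodes of that side. -/
def nodesOn (D : Dissection P n) (S : Set Plane) : Set D.Node := {v | (v : Plane) ∈ S}

/-- The skeleton graph: two distinct nodes are joined by an edge if they lie on the same side of
a triangle and the segment between them contains no other node. -/
def skeletonGraph (D : Dissection P n) : SimpleGraph D.Node where
  Adj u v := u ≠ v ∧
    (∃ (i : Fin n) (j j' : Fin 3), j ≠ j' ∧
      u ∈ D.nodesOn (D.triSide i j j') ∧ v ∈ D.nodesOn (D.triSide i j j')) ∧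
    ∀ w : D.Node, (w : Plane) ∈ segment ℝ (u : Plane) (v : Plane) → w = u ∨ w = v
  symm := ⟨by
    rintro u v ⟨hne, ⟨i, j, j', hj, hu, hv⟩, h⟩
    refine ⟨hne.symm, ⟨i, j, j', hj, hv, hu⟩, fun w hw => ?_⟩
    rw [segment_symm] at hw
    exact (h w hw).symm⟩
  loopless := ⟨fun _ h => h.1 rfl⟩

/-! ### Framed maps -/

/-- A framed map, a map from the nodes of the skeleton graph to the plane that sends the
corner nodes to the corresponding corners of `P`. -/
def IsFramedMap (D : Dissection P n) (φ : D.Node → Plane) : Prop :=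
  ∀ (v : D.Node) (m : Fin k), (v : Plane) = P.corners m → φ v = P.corners m

/-- A constrained framed map: for every side of every face of the skeleton graph (of every
triangle, and of the outside face, whose sides are those of `P`), the two corners and the side
nodes of that side are sent to a line. -/
structure IsConstrainedFramedMap (D : Dissection P n) (φ : D.Node → Plane) : Prop where
  isFramedMap : D.IsFramedMap φ
  collinear_triSide : ∀ (i : Fin n) (j j' : Fin 3), j ≠ j' →
    Collinear ℝ (φ '' D.nodesOn (D.triSide i j j'))
  collinear_side : ∀ m : Fin k, Collinear ℝ (φ '' D.nodesOn (P.side m))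

end Dissection

/-! ### Areas of faces -/

/-- The signed area of the triangle with corners `a`, `b`, `c`. -/
def signedArea (a b c : Plane) : ℝ :=
  (1 / 2 : ℝ) * Matrix.det !![1, 1, 1; a 0, b 0, c 0; a 1, b 1, c 1]

/-- The unsigned area of the `i`-th triangular face with respect to `φ`: the absolute value of
its signed area (which does not depend on the order in which the corners are listed). -/
def Dissection.unsignedArea {k : ℕ} [NeZero k] {P : SimplePolygon k} {n : ℕ}
    (D : Dissection P n) (φ : D.Node → Plane) (i : Fin n) : ℝ :=
  |signedArea (φ (D.corner i 0)) (φ (D.corner i 1)) (φ (D.corner i 2))|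

/-! ### The coloring of the plane -/

/-- A 2-adic valuation on `ℝ`, written multiplicatively: a nonarchimedean absolute value on `ℝ`
that extends the 2-adic absolute value of `ℚ`. -/
structure IsTwoAdic (v : AbsoluteValue ℝ ℝ) : Prop where
  nonarch : IsNonarchimedean v
  extends_padicNorm : ∀ q : ℚ, v (q : ℝ) = ((padicNorm 2 q : ℚ) : ℝ)

inductive Color : Type
  | red
  | green
  | blue

open Classical in
/-- The color of a point `(x, y)` is given by the first entry of `(|x|₂, |y|₂, 1)` that equals
their maximum. -/
def color (v : AbsoluteValue ℝ ℝ) (p : Plane) : Color :=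
  if v (p 0) = max (max (v (p 0)) (v (p 1))) 1 then Color.red
  else if v (p 1) = max (max (v (p 0)) (v (p 1))) 1 then Color.green
  else Color.blue

/-- The `i`-th side of `P` is red-blue: one of its endpoints is red and the other is blue. -/
def SimplePolygon.IsRedBlueSide {k : ℕ} [NeZero k] (P : SimplePolygon k)
    (v : AbsoluteValue ℝ ℝ) (i : Fin k) : Prop :=
  (color v (P.corners i) = Color.red ∧ color v (P.corners (finRotate k i)) = Color.blue) ∨
  (color v (P.corners i) = Color.blue ∧ color v (P.corners (finRotate k i)) = Color.red)

end

/-! The proof is Monsky's argument, with the faces allowed to be moved, flipped or degenerate. On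
one side, the sum over the faces of the signed `φ`-area, with the sign of the orientation of the
original triangle, does not depend on `φ`: it is a sum over the sides of `P`, and taking `φ` to be
the inclusion shows that it is the area of `P` (`sum_sign_mul_orient_eq_volume`). If all unsigned
areas equal `α`, then an odd integer times `α` is the integral area of `P`, so `|α|₂ ≤ 1` and `|2α|₂
≤ 1/2`.

On the other side, the determinant of a triple with three different colors has 2-adic value at least
`1` (`one_le_orient_of_rainbow`). Hence a line carries at most two colors, and a Sperner parity
count with the odd number of red-blue sides yields a rainbow face (`exists_rainbow_face`). For this
face `|2α|₂ ≥ 1`, a contradiction.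

Both halves are instances of one discrete Stokes formula, `sum_boundarySum`, for an antisymmetric
function on pairs of nodes that is additive along sides: `cross` with values in `ℝ` and `redBlue`
with values in `ZMod 2`. Its geometric input is `triBoundary_eq`: the jump of the indicator of `P`
across a segment between neighboring nodes is computed once from the triangles and once from the
sides of `P`. Neither the Jordan curve theorem nor a consistent orientation of the boundary of `P`
is used. -/

noncomputable section

open Set Filter Topology

/-! ### Cross product and orientation in the plane -/

/-- The two-dimensional cross product. -/
def cross (a b : Plane) : ℝ := a 0 * b 1 - a 1 * b 0

/-- Twice the signed area of the triangle `a b c`. -/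
def orient (a b c : Plane) : ℝ := cross (b - a) (c - a)

theorem signedArea_eq_orient (a b c : Plane) : signedArea a b c = orient a b c / 2 := by
  simp [signedArea, orient, cross, Matrix.det_fin_three]
  ring

theorem orient_rotate (a b c : Plane) : orient b c a = orient a b c := by
  simp [orient, cross]; ring

theorem orient_eq_cross_add (a b c : Plane) :
    orient a b c = cross a b + cross b c + cross c a := by
  simp [orient, cross]; ring

theorem orient_add_add (a b c x : Plane) :
    orient b c x + orient c a x + orient a b x = orient a b c := by
  simp [orient, cross]; ring

theorem lineMap_coord (a b : Plane) (t : ℝ) (i : Fin 2) :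
    (AffineMap.lineMap a b t : Plane) i = a i + t * (b i - a i) := by
  simp [AffineMap.lineMap_apply]; ring

theorem orient_lineMap (a b c d : Plane) (t : ℝ) :
    orient a b (AffineMap.lineMap c d t) = (1 - t) * orient a b c + t * orient a b d := by
  simp only [orient, cross, PiLp.sub_apply, lineMap_coord]; ring

theorem orient_self_lineMap (a b : Plane) (t : ℝ) : orient a b (AffineMap.lineMap a b t) = 0 := by
  simp only [orient, cross, PiLp.sub_apply, lineMap_coord]; ring

theorem orient_self_left (a b : Plane) : orient a b a = 0 := by
  simp [orient, cross]

theorem orient_self_right (a b : Plane) : orient a b b = 0 := by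
  simp [orient, cross]; ring

/-- `orient a b` is affine with linear part `cross (b - a)`, so any of its zeros can serve as
origin. This centers the half planes of a triangle at `p`. -/
theorem orient_eq_cross_sub {a b p : Plane} (h : orient a b p = 0) (x : Plane) :
    orient a b x = cross (b - a) (x - p) := by
  simp only [orient, cross, PiLp.sub_apply] at *; linarith

theorem cross_smul_left (r : ℝ) (a b : Plane) : cross (r • a) b = r * cross a b := by
  simp [cross]; ring

theorem cross_smul_right (r : ℝ) (a b : Plane) : cross a (r • b) = r * cross a b := by
  simp [cross]; ring

theorem cross_neg_left (a b : Plane) : cross (-a) b = - cross a b := by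
  simp [cross]; ring

theorem cross_swap (a b : Plane) : cross a b = - cross b a := by
  simp [cross]; ring

theorem cross_add_right (a b c : Plane) : cross a (b + c) = cross a b + cross a c := by
  simp [cross]; ring

@[simp] theorem cross_self_eq_zero (a : Plane) : cross a a = 0 := by
  simp [cross]; ring

@[fun_prop]
theorem continuous_cross (w : Plane) : Continuous (cross w) := by
  unfold cross; fun_prop

@[fun_prop]
theorem continuous_orient (a b : Plane) : Continuous (orient a b) := by
  unfold orient; fun_prop

theorem Plane.ext_coords {a b : Plane} (h0 : a 0 = b 0) (h1 : a 1 = b 1) : a = b := by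
  ext i; fin_cases i
  · exact h0
  · exact h1

theorem exists_eq_lineMap_of_orient_eq_zero {a b x : Plane} (hab : a ≠ b)
    (h : orient a b x = 0) : ∃ t : ℝ, x = AffineMap.lineMap a b t := by
  simp only [orient, cross, PiLp.sub_apply] at h
  by_cases h0 : b 0 - a 0 = 0
  · have h1 : b 1 - a 1 ≠ 0 := fun h1 =>
      hab (Plane.ext_coords (by linarith) (by linarith))
    refine ⟨(x 1 - a 1) / (b 1 - a 1), Plane.ext_coords ?_ ?_⟩
    · rw [lineMap_coord, h0]
      rw [h0] at h
      have : x 0 - a 0 = 0 := by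
        rcases mul_eq_zero.1 (show (b 1 - a 1) * (x 0 - a 0) = 0 by linarith) with h | h
        · exact absurd h h1
        · exact h
      linarith
    · rw [lineMap_coord]; field_simp; ring
  · refine ⟨(x 0 - a 0) / (b 0 - a 0), Plane.ext_coords ?_ ?_⟩
    · rw [lineMap_coord]; field_simp; ring
    · rw [lineMap_coord]; field_simp; linarith

theorem orient_eq_zero_of_mem_segment {a b p : Plane} (h : p ∈ segment ℝ a b) :
    orient a b p = 0 := by
  rw [segment_eq_image_lineMap] at h
  obtain ⟨t, -, rfl⟩ := h
  exact orient_self_lineMap a b t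

/-- Two side lines of a nondegenerate triangle meet only in the shared vertex. A point other than
the corners thus lies on at most one side line. -/
theorem eq_of_orient_eq_zero {a b c p : Plane} (hD : orient a b c ≠ 0)
    (h1 : orient a b p = 0) (h2 : orient b c p = 0) : p = b := by
  have hab : a ≠ b := by rintro rfl; simp [orient, cross] at hD
  obtain ⟨t, rfl⟩ := exists_eq_lineMap_of_orient_eq_zero hab h1
  rw [orient_lineMap, orient_rotate, orient_self_left] at h2
  have : t = 1 := by
    rcases mul_eq_zero.1 (show (1 - t) * orient a b c = 0 by linarith) with h | h
    · linarith
    · exact absurd h hD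
  simp [this]

/-! ### Triangles -/

/-- Divided by `orient a b c`, the three orientations are the barycentric coordinates of `x`.
Multiplying instead of dividing makes the sign conditions valid for both orientations of the
triangle. -/
theorem mem_convexHull_triple_iff {a b c : Plane} (hD : orient a b c ≠ 0) (x : Plane) :
    x ∈ convexHull ℝ {a, b, c} ↔
      0 ≤ orient a b c * orient a b x ∧ 0 ≤ orient a b c * orient b c x ∧
        0 ≤ orient a b c * orient c a x := by
  constructor
  · have key : ∀ p q : Plane, 0 ≤ orient a b c * orient p q a → 0 ≤ orient a b c * orient p q b →
        0 ≤ orient a b c * orient p q c → x ∈ convexHull ℝ {a, b, c} →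
        0 ≤ orient a b c * orient p q x := by
      intro p q ha hb hc hx
      refine convexHull_min (t := {x | 0 ≤ orient a b c * orient p q x}) ?_ ?_ hx
      · rintro y (rfl | rfl | rfl) <;> assumption
      · rw [convex_iff_segment_subset]
        intro y hy z hz w hw
        rw [segment_eq_image_lineMap] at hw
        obtain ⟨t, ht, rfl⟩ := hw
        simp only [mem_ofPred_eq, orient_lineMap] at *
        have := mul_nonneg (sub_nonneg.2 ht.2) hy
        have := mul_nonneg ht.1 hz
        linarith
    intro hx
    refine ⟨key a b ?_ ?_ ?_ hx, key b c ?_ ?_ ?_ hx, key c a ?_ ?_ ?_ hx⟩ <;>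
      simp only [orient_self_left, orient_self_right, mul_zero, le_refl, orient_rotate b c a,
        orient_rotate a b c, mul_self_nonneg]
  · rintro ⟨h1, h2, h3⟩
    have hs := orient_add_add a b c x
    have hDD : 0 < orient a b c * orient a b c := mul_self_pos.2 hD
    have key : x = (orient b c x / orient a b c) • a + ((orient c a x / orient a b c) • b
        + (orient a b x / orient a b c) • c) := by
      apply Plane.ext_coords <;> simp only [PiLp.add_apply, PiLp.smul_apply, smul_eq_mul] <;>
        field_simp <;> simp only [orient, cross, PiLp.sub_apply] <;> ring
    have hnn : ∀ r, 0 ≤ orient a b c * r → 0 ≤ r / orient a b c := fun r hr => by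
      rw [show r / orient a b c = (orient a b c * r) / (orient a b c * orient a b c) by
        field_simp]
      positivity
    have hmem := (convex_convexHull ℝ ({a, b, c} : Set Plane)).sum_mem (t := Finset.univ)
      (w := ![orient b c x / orient a b c, orient c a x / orient a b c,
        orient a b x / orient a b c]) (z := ![a, b, c])
      (by intro i _; fin_cases i <;> simp [hnn, h1, h2, h3])
      (by simp only [Fin.sum_univ_three]; simp; rw [← add_div, ← add_div, hs, div_self hD])
      (by intro i _; apply subset_convexHull; fin_cases i <;> simp)
    rw [key]
    simpa [Fin.sum_univ_three, add_assoc] using hmem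

theorem mem_interior_triple {a b c : Plane} (hD : orient a b c ≠ 0) {x : Plane}
    (hx : x ∈ convexHull ℝ {a, b, c}) (h1 : orient a b x ≠ 0) (h2 : orient b c x ≠ 0)
    (h3 : orient c a x ≠ 0) : x ∈ interior (convexHull ℝ {a, b, c}) := by
  rw [mem_convexHull_triple_iff hD] at hx
  have hpos : ∀ r : ℝ, r ≠ 0 → 0 ≤ orient a b c * r → 0 < orient a b c * r := fun r hr h =>
    lt_of_le_of_ne h (mul_ne_zero hD hr).symm
  refine interior_maximal (s := convexHull ℝ {a, b, c})
    (t := {x | 0 < orient a b c * orient a b x} ∩ {x | 0 < orient a b c * orient b c x}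
      ∩ {x | 0 < orient a b c * orient c a x}) ?_ ?_ ?_
  · rintro y ⟨⟨hy1, hy2⟩, hy3⟩
    rw [mem_convexHull_triple_iff hD]
    exact ⟨le_of_lt hy1, le_of_lt hy2, le_of_lt hy3⟩
  · refine ((isOpen_lt ?_ ?_).inter (isOpen_lt ?_ ?_)).inter (isOpen_lt ?_ ?_) <;> fun_prop
  · exact ⟨⟨hpos _ h1 hx.1, hpos _ h2 hx.2.1⟩, hpos _ h3 hx.2.2⟩

/-- Near a point of the relative interior of the side `a b`, a triangle is a half plane. -/
theorem eventually_mem_triple_iff {a b c : Plane} (hD : orient a b c ≠ 0) {p : Plane}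
    (hp : p ∈ convexHull ℝ {a, b, c}) (h1 : orient a b p = 0) (h2 : orient b c p ≠ 0)
    (h3 : orient c a p ≠ 0) :
    ∀ᶠ x in 𝓝 p, x ∈ convexHull ℝ {a, b, c} ↔ 0 ≤ orient a b c * cross (b - a) (x - p) := by
  rw [mem_convexHull_triple_iff hD] at hp
  have hpos : ∀ r : ℝ, r ≠ 0 → 0 ≤ orient a b c * r → 0 < orient a b c * r := fun r hr h =>
    lt_of_le_of_ne h (mul_ne_zero hD hr).symm
  have e2 : ∀ᶠ x in 𝓝 p, 0 < orient a b c * orient b c x :=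
    (isOpen_lt continuous_const (by fun_prop)).mem_nhds (hpos _ h2 hp.2.1)
  have e3 : ∀ᶠ x in 𝓝 p, 0 < orient a b c * orient c a x :=
    (isOpen_lt continuous_const (by fun_prop)).mem_nhds (hpos _ h3 hp.2.2)
  filter_upwards [e2, e3] with x hx2 hx3
  rw [mem_convexHull_triple_iff hD, orient_eq_cross_sub h1 x]
  exact ⟨fun h => h.1, fun h => ⟨h, le_of_lt hx2, le_of_lt hx3⟩⟩

theorem mem_openSegment_of_mem_triple {a b c : Plane} (hD : orient a b c ≠ 0) {p : Plane}
    (hp : p ∈ convexHull ℝ {a, b, c}) (h1 : orient a b p = 0) (h2 : orient b c p ≠ 0)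
    (h3 : orient c a p ≠ 0) : p ∈ openSegment ℝ a b := by
  rw [mem_convexHull_triple_iff hD] at hp
  have hab : a ≠ b := by rintro rfl; simp [orient, cross] at hD
  obtain ⟨t, rfl⟩ := exists_eq_lineMap_of_orient_eq_zero hab h1
  rw [openSegment_eq_image_lineMap]
  refine ⟨t, ?_, rfl⟩
  have e2 : orient b c (AffineMap.lineMap a b t) = (1 - t) * orient a b c := by
    rw [orient_lineMap, orient_rotate, orient_self_left]; ring
  have e3 : orient c a (AffineMap.lineMap a b t) = t * orient a b c := by
    rw [orient_lineMap, orient_self_right, orient_rotate b c a, orient_rotate a b c]; ring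
  rw [e2] at h2 hp
  rw [e3] at h3 hp
  have hDD : 0 < orient a b c * orient a b c := mul_self_pos.2 hD
  have ht0 : t ≠ 0 := fun h => h3 (by simp [h])
  have ht1 : 1 - t ≠ 0 := fun h => h2 (by simp [h])
  constructor
  · refine lt_of_le_of_ne ?_ ht0.symm
    by_contra! h
    nlinarith [hp.2.2]
  · refine lt_of_le_of_ne ?_ (fun h => ht1 (by linarith))
    by_contra! h
    nlinarith [hp.2.1]

theorem interior_triple_nonempty {a b c : Plane} (hD : orient a b c ≠ 0) :
    (interior (convexHull ℝ {a, b, c})).Nonempty := by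
  set x : Plane := (1 / 3 : ℝ) • (a + b + c)
  have e1 : orient a b x = orient a b c / 3 := by
    simp [orient, cross, x]; ring
  have e2 : orient b c x = orient a b c / 3 := by
    simp [orient, cross, x]; ring
  have e3 : orient c a x = orient a b c / 3 := by
    simp [orient, cross, x]; ring
  have hne : orient a b c / 3 ≠ 0 := by positivity
  refine ⟨x, mem_interior_triple hD ?_ (e1 ▸ hne) (e2 ▸ hne) (e3 ▸ hne)⟩
  rw [mem_convexHull_triple_iff hD, e1, e2, e3]
  have hDD : 0 < orient a b c * orient a b c := mul_self_pos.2 hD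
  refine ⟨?_, ?_, ?_⟩ <;> linarith

theorem isClosed_convexHull_triple (a b c : Plane) :
    IsClosed (convexHull ℝ ({a, b, c} : Set Plane)) :=
  (Set.toFinite ({a, b, c} : Set Plane)).isClosed_convexHull ℝ

theorem orient_ne_zero_of_affineIndependent {a b c : Plane}
    (h : AffineIndependent ℝ ![a, b, c]) : orient a b c ≠ 0 := by
  intro h0
  have hab : a ≠ b := fun hab => by simpa using h.injective.ne (by decide : (0 : Fin 3) ≠ 1) hab
  obtain ⟨t, rfl⟩ := exists_eq_lineMap_of_orient_eq_zero hab h0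
  rw [affineIndependent_iff_not_collinear_set] at h
  apply h
  rw [show ({a, b, AffineMap.lineMap a b t} : Set Plane)
    = insert (AffineMap.lineMap a b t) {a, b} by ext; simp; tauto]
  exact collinear_insert_of_mem_affineSpan_pair (AffineMap.lineMap_mem_affineSpan_pair t a b)

theorem orient_eq_zero_of_collinear {a b c : Plane} (h : Collinear ℝ {a, b, c}) :
    orient a b c = 0 := by
  obtain ⟨p, w, hw⟩ := (collinear_iff_exists_forall_eq_smul_vadd _).1 h
  obtain ⟨r, rfl⟩ := hw a (by simp)
  obtain ⟨s, rfl⟩ := hw b (by simp)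
  obtain ⟨t, rfl⟩ := hw c (by simp)
  simp [orient, cross]; ring

/-! ### Jumps of a planar set across a line -/

/-- The open half plane to the left of the line through `p` with direction `w`. -/
def leftOf (w p : Plane) : Set Plane := {x | 0 < cross w (x - p)}

open Classical in
/-- The integer-valued indicator of a proposition. -/
def ind (A : Prop) : ℤ := if A then 1 else 0

theorem ind_of {A : Prop} (h : A) : ind A = 1 := if_pos h

theorem ind_of_not {A : Prop} (h : ¬A) : ind A = 0 := if_neg h

/-- The set `S` has, near `p`, constant indicator on each side of the line through `p` with
direction `w`, and `J` is the left value minus the right value. -/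
def HasJump (S : Set Plane) (w p : Plane) (J : ℤ) : Prop :=
  ∃ l r : ℤ, (∀ᶠ x in 𝓝[leftOf w p] p, ind (x ∈ S) = l) ∧
    (∀ᶠ x in 𝓝[leftOf (-w) p] p, ind (x ∈ S) = r) ∧ l - r = J

theorem exists_cross_pos {w : Plane} (hw : w ≠ 0) : ∃ y : Plane, 0 < cross w y := by
  refine ⟨!₂[-w 1, w 0], ?_⟩
  have : w 0 ≠ 0 ∨ w 1 ≠ 0 := by
    by_contra! h
    exact hw (Plane.ext_coords h.1 h.2)
  simp only [cross]
  simp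
  rcases this with h | h
  · nlinarith [mul_self_pos.2 h, mul_self_nonneg (w 1)]
  · nlinarith [mul_self_pos.2 h, mul_self_nonneg (w 0)]

theorem tendsto_add_smul (p y : Plane) :
    Tendsto (fun t : ℝ => p + t • y) (𝓝[>] 0) (𝓝 p) := by
  have : Tendsto (fun t : ℝ => p + t • y) (𝓝 0) (𝓝 (p + (0 : ℝ) • y)) :=
    Continuous.tendsto (by fun_prop) 0
  simp only [zero_smul, add_zero] at this
  exact this.mono_left nhdsWithin_le_nhds

theorem leftOf_neBot {w : Plane} (hw : w ≠ 0) (p : Plane) : (𝓝[leftOf w p] p).NeBot := by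
  obtain ⟨y, hy⟩ := exists_cross_pos hw
  have : Tendsto (fun t : ℝ => p + t • y) (𝓝[>] 0) (𝓝[leftOf w p] p) := by
    refine tendsto_nhdsWithin_iff.2 ⟨tendsto_add_smul p y, ?_⟩
    filter_upwards [self_mem_nhdsWithin] with t ht
    simp only [leftOf, mem_ofPred_eq, add_sub_cancel_left, cross_smul_right]
    exact mul_pos ht hy
  exact this.neBot

/-- For `w ≠ 0` both half planes accumulate at `p`, so the two one-sided values are determined. -/
theorem HasJump.unique {S : Set Plane} {w p : Plane} (hw : w ≠ 0) {J J' : ℤ}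
    (h : HasJump S w p J) (h' : HasJump S w p J') : J = J' := by
  obtain ⟨l, r, hl, hr, rfl⟩ := h
  obtain ⟨l', r', hl', hr', rfl⟩ := h'
  have := leftOf_neBot hw p
  have := leftOf_neBot (neg_ne_zero.2 hw) p
  obtain ⟨x, hx, hx'⟩ := (hl.and hl').exists
  obtain ⟨y, hy, hy'⟩ := (hr.and hr').exists
  rw [← hx, ← hx', ← hy, ← hy']

theorem HasJump.neg {S : Set Plane} {w p : Plane} {J : ℤ} (h : HasJump S w p J) :
    HasJump S (-w) p (-J) := by
  obtain ⟨l, r, hl, hr, rfl⟩ := h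
  exact ⟨r, l, hr, by rwa [neg_neg], by ring⟩

theorem leftOf_smul {κ : ℝ} (hκ : 0 < κ) (w p : Plane) : leftOf (κ • w) p = leftOf w p := by
  ext x
  simp [leftOf, cross_smul_left, hκ]

theorem HasJump.smul {S : Set Plane} {w p : Plane} {J : ℤ} (h : HasJump S w p J) {κ : ℝ}
    (hκ : 0 < κ) : HasJump S (κ • w) p J := by
  obtain ⟨l, r, hl, hr, rfl⟩ := h
  exact ⟨l, r, by rwa [leftOf_smul hκ], by rwa [← smul_neg, leftOf_smul hκ], rfl⟩

theorem hasJump_zero_of_notMem_frontier {S : Set Plane} {w p : Plane} (h : p ∉ frontier S) :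
    HasJump S w p 0 := by
  by_cases hi : p ∈ interior S
  · have : ∀ᶠ x in 𝓝 p, ind (x ∈ S) = 1 := by
      filter_upwards [mem_interior_iff_mem_nhds.1 hi] with x hx using ind_of hx
    exact ⟨1, 1, this.filter_mono nhdsWithin_le_nhds, this.filter_mono nhdsWithin_le_nhds, rfl⟩
  · have hc : p ∉ closure S := fun hc => h ⟨hc, hi⟩
    have : ∀ᶠ x in 𝓝 p, ind (x ∈ S) = 0 := by
      filter_upwards [isClosed_closure.isOpen_compl.mem_nhds hc] with x hx using
        ind_of_not fun h => hx (subset_closure h)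
    exact ⟨0, 0, this.filter_mono nhdsWithin_le_nhds, this.filter_mono nhdsWithin_le_nhds, rfl⟩

/-- The indicator identity is required only off the line, because on the line itself adjacent
triangles overlap. -/
theorem HasJump.sum {ι : Type*} [Fintype ι] {T : ι → Set Plane} {S : Set Plane} {w p : Plane}
    {J : ι → ℤ} (h : ∀ i, HasJump (T i) w p (J i))
    (hl : ∀ᶠ x in 𝓝[leftOf w p] p, ind (x ∈ S) = ∑ i, ind (x ∈ T i))
    (hr : ∀ᶠ x in 𝓝[leftOf (-w) p] p, ind (x ∈ S) = ∑ i, ind (x ∈ T i)) :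
    HasJump S w p (∑ i, J i) := by
  choose l r h1 h2 h3 using h
  refine ⟨∑ i, l i, ∑ i, r i, ?_, ?_, ?_⟩
  · filter_upwards [hl, eventually_all.2 h1] with x hx hx'
    rw [hx]; exact Finset.sum_congr rfl fun i _ => hx' i
  · filter_upwards [hr, eventually_all.2 h2] with x hx hx'
    rw [hx]; exact Finset.sum_congr rfl fun i _ => hx' i
  · rw [← Finset.sum_sub_distrib]; exact Finset.sum_congr rfl fun i _ => h3 i

theorem hasJump_halfPlane {S : Set Plane} {w p : Plane} {D : ℝ} (hD : D ≠ 0)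
    (h : ∀ᶠ x in 𝓝 p, x ∈ S ↔ 0 ≤ D * cross w (x - p)) :
    HasJump S w p (SignType.sign D : ℤ) := by
  rcases lt_or_gt_of_ne hD with hD | hD
  · refine ⟨0, 1, ?_, ?_, by simp [sign_neg hD]⟩
    · filter_upwards [h.filter_mono nhdsWithin_le_nhds, self_mem_nhdsWithin] with x hx hx'
      refine ind_of_not fun hS => ?_
      simp only [leftOf, mem_ofPred_eq] at hx'
      nlinarith [hx.1 hS]
    · filter_upwards [h.filter_mono nhdsWithin_le_nhds, self_mem_nhdsWithin] with x hx hx'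
      refine ind_of (hx.2 ?_)
      simp only [leftOf, mem_ofPred_eq, cross_neg_left] at hx'
      nlinarith
  · refine ⟨1, 0, ?_, ?_, by simp [sign_pos hD]⟩
    · filter_upwards [h.filter_mono nhdsWithin_le_nhds, self_mem_nhdsWithin] with x hx hx'
      refine ind_of (hx.2 ?_)
      simp only [leftOf, mem_ofPred_eq] at hx'
      nlinarith
    · filter_upwards [h.filter_mono nhdsWithin_le_nhds, self_mem_nhdsWithin] with x hx hx'
      refine ind_of_not fun hS => ?_
      simp only [leftOf, mem_ofPred_eq, cross_neg_left] at hx'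
      nlinarith [hx.1 hS]

/-! ### Directed subsegments -/

/-- The directed segment from `u` to `v` runs along the stretch of the parametrized line `L`
between the parameters `s` and `t`. -/
def AlongLine (L : ℝ →ᵃ[ℝ] Plane) (s t : ℝ) (u v : Plane) : Prop :=
  ∃ α β, s ≤ α ∧ α < β ∧ β ≤ t ∧ u = L α ∧ v = L β

/-- The directed segment from `u` to `v` is part of the directed segment from `a` to `b`. -/
def Along (a b u v : Plane) : Prop := AlongLine (AffineMap.lineMap a b) 0 1 u v

theorem openSegment_affineMap (L : ℝ →ᵃ[ℝ] Plane) {α β : ℝ} (h : α < β) :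
    openSegment ℝ (L α) (L β) = L '' Ioo α β := by
  rw [← openSegment_eq_Ioo h, image_openSegment]

theorem Along.openSegment_subset {a b u v : Plane} (h : Along a b u v) :
    openSegment ℝ u v ⊆ segment ℝ a b := by
  obtain ⟨α, β, h1, h2, h3, rfl, rfl⟩ := h
  rw [openSegment_affineMap _ h2, segment_eq_image_lineMap]
  exact image_mono fun x hx => ⟨h1.trans hx.1.le, hx.2.le.trans h3⟩

theorem Along.symm_openSegment_subset {a b u v : Plane} (h : Along a b v u) :
    openSegment ℝ u v ⊆ segment ℝ a b := by
  rw [openSegment_symm]; exact h.openSegment_subset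

theorem Along.not_symm {a b u v : Plane} (hab : a ≠ b) (h : Along a b u v) :
    ¬ Along a b v u := by
  obtain ⟨α, β, h1, h2, h3, rfl, rfl⟩ := h
  rintro ⟨α', β', h1', h2', h3', h, h'⟩
  have inj := AffineMap.lineMap_injective ℝ hab
  have := inj h
  have := inj h'
  linarith

/-- A segment on the line `a b` that meets the open segment `a b` but does not have `a` or `b` in
its relative interior runs along the segment `a b` in one of the two directions. -/
theorem along_or_along {a b u v p : Plane} (hab : a ≠ b) (huv : u ≠ v)
    (hp : p ∈ openSegment ℝ a b) (hpuv : p ∈ openSegment ℝ u v)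
    (ha : a ∉ openSegment ℝ u v) (hb : b ∉ openSegment ℝ u v)
    (hu : orient a b u = 0) (hv : orient a b v = 0) :
    (∃ κ : ℝ, 0 < κ ∧ v - u = κ • (b - a) ∧ Along a b u v) ∨
      (∃ κ : ℝ, 0 < κ ∧ v - u = κ • -(b - a) ∧ Along a b v u) := by
  have inj := AffineMap.lineMap_injective ℝ hab
  set L : ℝ →ᵃ[ℝ] Plane := AffineMap.lineMap a b with hL
  have key : ∀ α β : ℝ, α < β → p ∈ openSegment ℝ (L α) (L β) →
      a ∉ openSegment ℝ (L α) (L β) → b ∉ openSegment ℝ (L α) (L β) →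
      Along a b (L α) (L β) := by
    intro α β hαβ hp' ha' hb'
    rw [openSegment_affineMap L hαβ] at hp' ha' hb'
    rw [openSegment_eq_image_lineMap] at hp
    obtain ⟨s, hs, rfl⟩ := hp
    obtain ⟨s', hs', h⟩ := hp'
    obtain rfl := inj h
    refine ⟨α, β, ?_, hαβ, ?_, rfl, rfl⟩
    · by_contra! hlt
      exact ha' ⟨0, ⟨hlt, hs.1.trans hs'.2⟩, by simp [hL]⟩
    · by_contra! hlt
      exact hb' ⟨1, ⟨hs'.1.trans hs.2, hlt⟩, by simp [hL]⟩
  have hsub : ∀ α β : ℝ, L β - L α = (β - α) • (b - a) := by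
    intro α β
    apply Plane.ext_coords <;> simp [hL, lineMap_coord] <;> ring
  obtain ⟨α, rfl⟩ := exists_eq_lineMap_of_orient_eq_zero hab hu
  obtain ⟨β, rfl⟩ := exists_eq_lineMap_of_orient_eq_zero hab hv
  rcases lt_trichotomy α β with h | h | h
  · exact Or.inl ⟨β - α, sub_pos.2 h, hsub α β, key α β h hpuv ha hb⟩
  · exact absurd (by rw [h]) huv
  · rw [openSegment_symm] at hpuv ha hb
    refine Or.inr ⟨α - β, sub_pos.2 h, ?_, key β α h hpuv ha hb⟩
    rw [hsub α β, smul_neg, ← neg_smul, neg_sub]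

/-! ### The jump of a triangle -/

/-- The signed number of times that the directed segment from `u` to `v` runs along the directed
segment from `a` to `b`. -/
def alongSign (a b u v : Plane) : ℤ := ind (Along a b u v) - ind (Along a b v u)

theorem alongSign_eq_zero {a b u v p : Plane} (hp : p ∈ openSegment ℝ u v)
    (h : p ∉ segment ℝ a b) : alongSign a b u v = 0 := by
  rw [alongSign, ind_of_not fun h' => h (h'.openSegment_subset hp),
    ind_of_not fun h' => h (h'.symm_openSegment_subset hp), sub_self]

/-- Reversing the direction exchanges left and right and negates the jump, which is what `alongSign`
records; a positive rescaling changes nothing. -/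
theorem HasJump.along {S : Set Plane} {a b u v p : Plane} {J : ℤ} (h : HasJump S (b - a) p J)
    (hab : a ≠ b) (huv : u ≠ v)
    (hp : p ∈ openSegment ℝ a b) (hpuv : p ∈ openSegment ℝ u v)
    (ha : a ∉ openSegment ℝ u v) (hb : b ∉ openSegment ℝ u v)
    (hu : orient a b u = 0) (hv : orient a b v = 0) :
    HasJump S (v - u) p (J * alongSign a b u v) := by
  rcases along_or_along hab huv hp hpuv ha hb hu hv with ⟨κ, hκ, e, hA⟩ | ⟨κ, hκ, e, hA⟩
  · rw [e, alongSign, ind_of hA, ind_of_not (hA.not_symm hab)]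
    simpa using h.smul hκ
  · rw [e, alongSign, ind_of hA, ind_of_not (hA.not_symm hab)]
    simpa using h.neg.smul hκ

theorem hasJump_triple_of_side {a b c u v p : Plane} (hD : orient a b c ≠ 0) (huv : u ≠ v)
    (hp : p ∈ openSegment ℝ u v)
    (ha : a ∉ openSegment ℝ u v) (hb : b ∉ openSegment ℝ u v)
    (hu : orient a b u = 0) (hv : orient a b v = 0) (h1 : orient a b p = 0) :
    HasJump (convexHull ℝ {a, b, c}) (v - u) p
      (SignType.sign (orient a b c) *
        (alongSign a b u v + alongSign b c u v + alongSign c a u v)) := by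
  have hab : a ≠ b := by rintro rfl; simp [orient, cross] at hD
  have h2 : orient b c p ≠ 0 := fun h2 => hb (eq_of_orient_eq_zero hD h1 h2 ▸ hp)
  have h3 : orient c a p ≠ 0 := fun h3 => by
    have := eq_of_orient_eq_zero (a := c) (b := a) (c := b) (by rwa [orient_rotate b c a,
      orient_rotate a b c]) h3 h1
    exact ha (this ▸ hp)
  rw [alongSign_eq_zero (a := b) (b := c) hp fun h => h2 (orient_eq_zero_of_mem_segment h),
    alongSign_eq_zero (a := c) (b := a) hp fun h => h3 (orient_eq_zero_of_mem_segment h),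
    add_zero, add_zero]
  -- Either `p` is in the open side, where the triangle is a half plane, or it is outside the closed
  -- triangle, where both the jump and `alongSign` vanish.
  by_cases hT : p ∈ convexHull ℝ {a, b, c}
  · exact (hasJump_halfPlane hD (eventually_mem_triple_iff hD hT h1 h2 h3)).along hab huv
      (mem_openSegment_of_mem_triple hD hT h1 h2 h3) hp ha hb hu hv
  · rw [alongSign_eq_zero hp, mul_zero]
    · refine hasJump_zero_of_notMem_frontier fun h => hT ?_
      exact (isClosed_convexHull_triple a b c).frontier_subset h
    · exact fun h => hT (segment_subset_convexHull (by simp) (by simp) h)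

/-- If `p` is on a side line, rotating the corners reduces to `hasJump_triple_of_side`. Otherwise
`p` is not on the frontier and both quantities are zero. -/
theorem hasJump_triple {a b c u v p : Plane} (hD : orient a b c ≠ 0) (huv : u ≠ v)
    (hp : p ∈ openSegment ℝ u v)
    (ha : a ∉ openSegment ℝ u v) (hb : b ∉ openSegment ℝ u v) (hc : c ∉ openSegment ℝ u v)
    (hab : orient a b p = 0 → orient a b u = 0 ∧ orient a b v = 0)
    (hbc : orient b c p = 0 → orient b c u = 0 ∧ orient b c v = 0)
    (hca : orient c a p = 0 → orient c a u = 0 ∧ orient c a v = 0) :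
    HasJump (convexHull ℝ {a, b, c}) (v - u) p
      (SignType.sign (orient a b c) *
        (alongSign a b u v + alongSign b c u v + alongSign c a u v)) := by
  have r1 := orient_rotate a b c
  have r2 := orient_rotate b c a
  by_cases h1 : orient a b p = 0
  · exact hasJump_triple_of_side hD huv hp ha hb (hab h1).1 (hab h1).2 h1
  by_cases h2 : orient b c p = 0
  · have := hasJump_triple_of_side (by rwa [r1]) huv hp hb hc (hbc h2).1 (hbc h2).2 h2
    rw [r1] at this
    convert! this using 2
    · ext; simp; tauto
    · ring
  by_cases h3 : orient c a p = 0
  · have := hasJump_triple_of_side (by rwa [r2, r1]) huv hp hc ha (hca h3).1 (hca h3).2 h3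
    rw [r2, r1] at this
    convert! this using 2
    · ext; simp; tauto
    · ring
  rw [alongSign_eq_zero (a := a) (b := b) hp fun h => h1 (orient_eq_zero_of_mem_segment h),
    alongSign_eq_zero (a := b) (b := c) hp fun h => h2 (orient_eq_zero_of_mem_segment h),
    alongSign_eq_zero (a := c) (b := a) hp fun h => h3 (orient_eq_zero_of_mem_segment h)]
  rw [add_zero, add_zero, mul_zero]
  refine hasJump_zero_of_notMem_frontier fun h => ?_
  exact h.2 (mem_interior_triple hD ((isClosed_convexHull_triple a b c).frontier_subset h)
    h1 h2 h3)

/-- A finite family of lines: a point of the segment `u v` which lies on no line of the family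
other than possibly the line `u v`. -/
theorem exists_generic_point {ι : Type*} [Finite ι] {u v : Plane} (a b : ι → Plane) :
    ∃ p ∈ openSegment ℝ u v, ∀ i, orient (a i) (b i) p = 0 →
      orient (a i) (b i) u = 0 ∧ orient (a i) (b i) v = 0 := by
  -- An affine function that does not vanish identically on the segment has at most one zero there,
  -- so only finitely many parameters are excluded.
  have hfin : ∀ i, {t : ℝ | orient (a i) (b i) (AffineMap.lineMap u v t) = 0 ∧
      ¬ (orient (a i) (b i) u = 0 ∧ orient (a i) (b i) v = 0)}.Finite := by
    intro i
    refine Set.Subsingleton.finite ?_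
    rintro s ⟨hs, h⟩ t ⟨ht, -⟩
    rw [orient_lineMap] at hs ht
    by_contra hst
    have h1 : (s - t) * (orient (a i) (b i) v - orient (a i) (b i) u) = 0 := by linarith
    have h2 := (mul_eq_zero.1 h1).resolve_left (sub_ne_zero.2 hst)
    have h3 : orient (a i) (b i) u = 0 := by
      have : orient (a i) (b i) v = orient (a i) (b i) u := by linarith
      rw [this] at hs; linarith
    exact h ⟨h3, by linarith⟩
  obtain ⟨t, ht, htn⟩ := ((Ioo_infinite (zero_lt_one (α := ℝ))).sdiff
    (Set.finite_iUnion hfin)).nonempty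
  refine ⟨AffineMap.lineMap u v t, ?_, fun i hi => ?_⟩
  · rw [openSegment_eq_image_lineMap]; exact ⟨t, ht, rfl⟩
  · by_contra h
    exact htn (mem_iUnion.2 ⟨i, hi, h⟩)

/-! ### Subdividing a segment at finitely many points -/

/-- No point of the family `x` lies strictly between the distinct points `u` and `v`. -/
def Elementary {N : Type*} (x : N → Plane) (u v : N) : Prop :=
  u ≠ v ∧ ∀ w, x w ∉ openSegment ℝ (x u) (x v)

theorem Elementary.symm {N : Type*} {x : N → Plane} {u v : N} (h : Elementary x u v) :
    Elementary x v u := ⟨h.1.symm, fun w => by rw [openSegment_symm]; exact h.2 w⟩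

-- Induction on the number of family points strictly inside the stretch: it is cut at one of them,
-- and every elementary pair falls into exactly one half. Summing over all pairs avoids ordering the
-- points; fixing `L` and varying the parameters keeps both halves in the same form.
open Classical in
theorem sum_subdivision {N G : Type*} [Fintype N] [AddCommGroup G] {x : N → Plane}
    (hx : Function.Injective x) {L : ℝ →ᵃ[ℝ] Plane} (hL : Function.Injective L)
    (f : N → N → G) (n : ℕ) : ∀ {s t : ℝ} (_ : s < t) {p q : N} (_ : x p = L s) (_ : x q = L t)
    (_ : ∀ u v w, x u ∈ L '' Icc s t → x v ∈ L '' Icc s t → x w ∈ L '' Icc s t →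
      f u v + f v w = f u w)
    (_ : {w | x w ∈ L '' Ioo s t}.ncard = n),
    f p q = ∑ u, ∑ v, if Elementary x u v ∧ AlongLine L s t (x u) (x v) then f u v else 0 := by
  induction n using Nat.strong_induction_on with
  | _ n ih =>
  intro s t hst p q hp hq hf hn
  by_cases hne : ∃ w, x w ∈ L '' Ioo s t
  · obtain ⟨w, γ, hγ, hw⟩ := hne
    have hsub : ∀ {s' t'}, s ≤ s' → t' ≤ t → γ ∉ Ioo s' t' →
        {w | x w ∈ L '' Ioo s' t'}.ncard < n := by
      intro s' t' hs' ht' hγ'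
      rw [← hn]
      refine Set.ncard_lt_ncard ⟨fun y hy => image_mono (Ioo_subset_Ioo hs' ht') hy, fun h => ?_⟩
        (Set.toFinite _)
      obtain ⟨γ', h1, h2⟩ := h (show w ∈ _ from ⟨γ, hγ, hw⟩)
      rw [← hw] at h2
      exact hγ' (hL h2 ▸ h1)
    have i1 := ih _ (hsub le_rfl hγ.2.le fun h => lt_irrefl _ h.2) hγ.1 hp hw.symm
      (fun u v w hu hv hw => hf u v w (image_mono (Icc_subset_Icc le_rfl hγ.2.le) hu)
        (image_mono (Icc_subset_Icc le_rfl hγ.2.le) hv)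
        (image_mono (Icc_subset_Icc le_rfl hγ.2.le) hw)) rfl
    have i2 := ih _ (hsub hγ.1.le le_rfl fun h => lt_irrefl _ h.1) hγ.2 hw.symm hq
      (fun u v w hu hv hw => hf u v w (image_mono (Icc_subset_Icc hγ.1.le le_rfl) hu)
        (image_mono (Icc_subset_Icc hγ.1.le le_rfl) hv)
        (image_mono (Icc_subset_Icc hγ.1.le le_rfl) hw)) rfl
    rw [← hf p w q ⟨s, ⟨le_rfl, hst.le⟩, hp.symm⟩ ⟨γ, ⟨hγ.1.le, hγ.2.le⟩, hw⟩
      ⟨t, ⟨hst.le, le_rfl⟩, hq.symm⟩, i1, i2, ← Finset.sum_add_distrib]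
    refine Finset.sum_congr rfl fun u _ => ?_
    rw [← Finset.sum_add_distrib]
    refine Finset.sum_congr rfl fun v _ => ?_
    by_cases hE : Elementary x u v
    · have hexcl : AlongLine L s γ (x u) (x v) → ¬ AlongLine L γ t (x u) (x v) := by
        rintro ⟨α, β, h1, h2, h3, h4, h5⟩ ⟨α', β', h1', h2', h3', h4', h5'⟩
        have := hL (h4.symm.trans h4')
        linarith
      have hiff : AlongLine L s t (x u) (x v) ↔
          AlongLine L s γ (x u) (x v) ∨ AlongLine L γ t (x u) (x v) := by
        constructor
        · rintro ⟨α, β, h1, h2, h3, h4, h5⟩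
          rcases le_or_gt β γ with h | h
          · exact Or.inl ⟨α, β, h1, h2, h, h4, h5⟩
          · refine Or.inr ⟨α, β, ?_, h2, h3, h4, h5⟩
            -- A pair straddling the cut would have `w` strictly between its points, so it would not
            -- be elementary.
            by_contra! h'
            apply hE.2 w
            rw [h4, h5, openSegment_affineMap L h2]
            exact ⟨γ, ⟨h', h⟩, hw⟩
        · rintro (⟨α, β, h1, h2, h3, h4, h5⟩ | ⟨α, β, h1, h2, h3, h4, h5⟩)
          · exact ⟨α, β, h1, h2, h3.trans hγ.2.le, h4, h5⟩
          · exact ⟨α, β, hγ.1.le.trans h1, h2, h3, h4, h5⟩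
      by_cases hA : AlongLine L s γ (x u) (x v)
      · simp [hE, hiff, hA, hexcl hA]
      · simp [hE, hiff, hA]
    · simp [hE]
  · push Not at hne
    have hiff : ∀ u v, Elementary x u v ∧ AlongLine L s t (x u) (x v) ↔ u = p ∧ v = q := by
      intro u v
      constructor
      · rintro ⟨-, α, β, h1, h2, h3, h4, h5⟩
        constructor
        · apply hx
          rw [h4, hp]
          congr 1
          by_contra h
          exact hne u ⟨α, ⟨lt_of_le_of_ne h1 (Ne.symm h), h2.trans_le h3⟩, h4.symm⟩
        · apply hx
          rw [h5, hq]
          congr 1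
          by_contra h
          exact hne v ⟨β, ⟨h1.trans_lt h2, lt_of_le_of_ne h3 h⟩, h5.symm⟩
      · rintro ⟨rfl, rfl⟩
        refine ⟨⟨?_, fun w => ?_⟩, s, t, le_rfl, hst, le_rfl, hp, hq⟩
        · rintro rfl
          exact hst.ne (hL (hp.symm.trans hq))
        · rw [hp, hq, openSegment_affineMap L hst]
          exact hne w
    simp only [hiff]
    rw [Finset.sum_eq_single p, Finset.sum_eq_single q] <;> simp +contextual

-- Integer coefficients on the common index set of node pairs let different segments be compared
-- coefficient by coefficient.
open Classical in
theorem sum_along {N G : Type*} [Fintype N] [AddCommGroup G] {x : N → Plane}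
    (hx : Function.Injective x) (f : N → N → G) {p q : N} (hpq : p ≠ q)
    (hf : ∀ u v w, x u ∈ segment ℝ (x p) (x q) → x v ∈ segment ℝ (x p) (x q) →
      x w ∈ segment ℝ (x p) (x q) → f u v + f v w = f u w) :
    f p q = ∑ u, ∑ v, (if Elementary x u v then ind (Along (x p) (x q) (x u) (x v)) else 0)
      • f u v := by
  rw [sum_subdivision hx (AffineMap.lineMap_injective ℝ (hx.ne hpq)) f _
    (zero_lt_one (α := ℝ)) (p := p) (q := q) (by simp) (by simp)
    (by simpa only [segment_eq_image_lineMap] using hf) rfl]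
  refine Finset.sum_congr rfl fun u _ => Finset.sum_congr rfl fun v _ => ?_
  by_cases hE : Elementary x u v <;> by_cases hA : Along (x p) (x q) (x u) (x v)
  · rw [if_pos hE, ind_of hA, if_pos ⟨hE, hA⟩, one_smul]
  · rw [if_pos hE, ind_of_not hA, if_neg (fun h => hA h.2), zero_smul]
  · rw [if_neg hE, if_neg (fun h => hE h.1), zero_smul]
  · rw [if_neg hE, if_neg (fun h => hE h.1), zero_smul]

/-! ### Local structure of a dissection -/

theorem cross_eq_zero_trans {w a b : Plane} (hw : w ≠ 0) (ha : cross w a = 0)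
    (hb : cross w b = 0) : cross a b = 0 := by
  simp only [cross] at *
  have : w 0 ≠ 0 ∨ w 1 ≠ 0 := by
    by_contra! h
    exact hw (Plane.ext_coords h.1 h.2)
  rcases this with h | h
  · have : w 0 * (a 0 * b 1 - a 1 * b 0) = 0 := by linear_combination a 0 * hb - b 0 * ha
    exact (mul_eq_zero.1 this).resolve_left h
  · have : w 1 * (a 0 * b 1 - a 1 * b 0) = 0 := by linear_combination a 1 * hb - b 1 * ha
    exact (mul_eq_zero.1 this).resolve_left h

theorem exists_cross_pos_pos {w w' : Plane} (h : cross w w' ≠ 0) :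
    ∃ y, 0 < cross w y ∧ 0 < cross w' y := by
  refine ⟨cross w w' • (w' - w), ?_, ?_⟩
  · have : cross w (cross w w' • (w' - w)) = cross w w' * cross w w' := by
      simp [cross]; ring
    rw [this]; exact mul_self_pos.2 h
  · have : cross w' (cross w w' • (w' - w)) = cross w w' * cross w w' := by
      simp [cross]; ring
    rw [this]; exact mul_self_pos.2 h

theorem exists_halfPlane_of_mem_triple {a b c p : Plane} (hD : orient a b c ≠ 0)
    (hp : p ∈ convexHull ℝ {a, b, c}) (hi : p ∉ interior (convexHull ℝ {a, b, c}))
    (ha : p ≠ a) (hb : p ≠ b) (hc : p ≠ c) :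
    ∃ w : Plane, w ≠ 0 ∧ ∀ᶠ x in 𝓝 p, x ∈ convexHull ℝ {a, b, c} ↔ 0 ≤ cross w (x - p) := by
  have key : ∀ {a b c : Plane}, orient a b c ≠ 0 → p ∈ convexHull ℝ {a, b, c} → p ≠ a → p ≠ b →
      orient a b p = 0 →
      ∃ w : Plane, w ≠ 0 ∧ ∀ᶠ x in 𝓝 p,
        x ∈ convexHull ℝ {a, b, c} ↔ 0 ≤ cross w (x - p) := by
    intro a b c hD hp ha hb h1
    have hab : a ≠ b := by rintro rfl; simp [orient, cross] at hD
    have h2 : orient b c p ≠ 0 := fun h2 => hb (eq_of_orient_eq_zero hD h1 h2)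
    have h3 : orient c a p ≠ 0 := fun h3 =>
      ha (eq_of_orient_eq_zero (a := c) (b := a) (c := b)
        (by rwa [orient_rotate b c a, orient_rotate a b c]) h3 h1)
    refine ⟨orient a b c • (b - a), smul_ne_zero hD (sub_ne_zero.2 hab.symm), ?_⟩
    simpa only [cross_smul_left] using eventually_mem_triple_iff hD hp h1 h2 h3
  have r1 := orient_rotate a b c
  have r2 := orient_rotate b c a
  have s1 : ({b, c, a} : Set Plane) = {a, b, c} := by ext; simp; tauto
  have s2 : ({c, a, b} : Set Plane) = {a, b, c} := by ext; simp; tauto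
  by_cases h1 : orient a b p = 0
  · exact key hD hp ha hb h1
  by_cases h2 : orient b c p = 0
  · have := key (by rwa [r1]) (by rwa [s1]) hb hc h2
    rwa [s1] at this
  by_cases h3 : orient c a p = 0
  · have := key (by rwa [r2, r1]) (by rwa [s2]) hc ha h3
    rwa [s2] at this
  exact absurd (mem_interior_triple hD hp h1 h2 h3) hi

theorem eventually_mem_interior_of_halfPlane {T : Set Plane} {w p : Plane}
    (h : ∀ᶠ x in 𝓝 p, x ∈ T ↔ 0 ≤ cross w (x - p)) :
    ∀ᶠ x in 𝓝 p, 0 < cross w (x - p) → x ∈ interior T := by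
  filter_upwards [eventually_eventually_nhds.2 h] with x hx hpos
  rw [mem_interior_iff_mem_nhds]
  have : ∀ᶠ y in 𝓝 x, 0 < cross w (y - p) :=
    (isOpen_lt continuous_const (by fun_prop)).mem_nhds hpos
  filter_upwards [hx, this] with y hy hy'
  exact hy.2 (le_of_lt hy')

/-- If `S` contains a half plane germ at `p`, no ray germ in its frontier enters that half
plane. -/
theorem cross_nonpos_of_eventually_frontier {S T : Set Plane} {w p y : Plane} (hTS : T ⊆ S)
    (h : ∀ᶠ x in 𝓝 p, x ∈ T ↔ 0 ≤ cross w (x - p))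
    (hy : ∀ᶠ t : ℝ in 𝓝[>] 0, p + t • y ∈ frontier S) : cross w y ≤ 0 := by
  by_contra! hpos
  obtain ⟨t, h1, h2, h3⟩ := (((tendsto_add_smul p y).eventually
    (eventually_mem_interior_of_halfPlane h)).and (hy.and self_mem_nhdsWithin)).exists
  refine h2.2 (interior_mono hTS (h1 ?_))
  rw [add_sub_cancel_left, cross_smul_right]
  exact mul_pos h3 hpos

theorem Fin.add_one_add_one {k : ℕ} [NeZero k] (i : Fin k) : i + 1 + 1 = i + 2 := by
  rw [add_assoc]
  congr 1
  ext
  simp [Fin.val_add]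

theorem range_fin_three {X : Type*} (f : Fin 3 → X) : Set.range f = {f 0, f 1, f 2} := by
  ext; simp [Fin.exists_fin_succ, eq_comm]

namespace Dissection

variable {k : ℕ} [NeZero k] {P : SimplePolygon k} {n : ℕ}

/-- The `i`-th triangle as a subset of the plane. -/
def triangle (D : Dissection P n) (i : Fin n) : Set Plane :=
  convexHull ℝ {(D.tri i).points 0, (D.tri i).points 1, (D.tri i).points 2}

/-- Twice the signed area of the `i`-th triangle. -/
def triOrient (D : Dissection P n) (i : Fin n) : ℝ :=
  orient ((D.tri i).points 0) ((D.tri i).points 1) ((D.tri i).points 2)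

theorem triangle_eq (D : Dissection P n) (i : Fin n) :
    D.triangle i = convexHull ℝ (Set.range (D.tri i).points) := by
  rw [range_fin_three]; rfl

theorem triOrient_ne_zero (D : Dissection P n) (i : Fin n) : D.triOrient i ≠ 0 := by
  apply orient_ne_zero_of_affineIndependent
  have : ![(D.tri i).points 0, (D.tri i).points 1, (D.tri i).points 2] = (D.tri i).points := by
    ext1 j; fin_cases j <;> rfl
  rw [this]
  exact (D.tri i).independent

theorem isClosed_triangle (D : Dissection P n) (i : Fin n) : IsClosed (D.triangle i) :=
  isClosed_convexHull_triple _ _ _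

theorem iUnion_triangle (D : Dissection P n) : ⋃ i, D.triangle i = P.carrier := by
  simp only [triangle_eq, D.iUnion_eq]

theorem triangle_subset (D : Dissection P n) (i : Fin n) : D.triangle i ⊆ P.carrier := by
  rw [← D.iUnion_triangle]; exact subset_iUnion _ i

theorem disjoint_interior (D : Dissection P n) {i j : Fin n} (h : i ≠ j) :
    Disjoint (interior (D.triangle i)) (interior (D.triangle j)) := by
  rw [triangle_eq, triangle_eq]; exact D.disjoint_interiors i j h

/-- Each triangle is the closure of its interior, hence so is the finite union. This rules out a
side of `P` with the exterior on both of its sides. -/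
theorem carrier_subset_closure_interior (D : Dissection P n) :
    P.carrier ⊆ closure (interior P.carrier) := by
  rw [← D.iUnion_triangle]
  refine iUnion_subset fun i x hx => ?_
  have h := (convex_convexHull ℝ _).closure_interior_eq_closure_of_nonempty_interior
    (interior_triple_nonempty (D.triOrient_ne_zero i))
  refine closure_mono (interior_mono (subset_iUnion _ i)) ?_
  change x ∈ closure (interior (convexHull ℝ _))
  rw [h]
  exact subset_closure hx

instance (D : Dissection P n) : Finite D.Node :=
  Set.Finite.to_subtype (Set.finite_iUnion fun _ => Set.finite_range _)

theorem point_mem_nodes (D : Dissection P n) (i : Fin n) (j : Fin 3) :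
    (D.tri i).points j ∈ D.nodes := mem_iUnion.2 ⟨i, mem_range_self j⟩

/-- There are finitely many triangles, so one of them catches the ray arbitrarily close to `p`;
being closed, it contains `p`. -/
theorem exists_triangle_of_frequently (D : Dissection P n) {p y : Plane}
    (h : ∃ᶠ t : ℝ in 𝓝[>] 0, p + t • y ∈ P.carrier) :
    ∃ i, p ∈ D.triangle i ∧ ∃ᶠ t : ℝ in 𝓝[>] 0, p + t • y ∈ D.triangle i := by
  have : ∃ i, ∃ᶠ t : ℝ in 𝓝[>] 0, p + t • y ∈ D.triangle i := by
    by_contra! hcon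
    refine h ?_
    filter_upwards [eventually_all.2 hcon] with t ht hmem
    rw [← D.iUnion_triangle] at hmem
    obtain ⟨i, hi⟩ := mem_iUnion.1 hmem
    exact ht i hi
  obtain ⟨i, hi⟩ := this
  refine ⟨i, ?_, hi⟩
  rw [← (D.isClosed_triangle i).closure_eq, mem_closure_iff_frequently]
  exact (tendsto_add_smul p y).frequently hi

end Dissection

namespace SimplePolygon

variable {k : ℕ} [NeZero k]

theorem side_eq (P : SimplePolygon k) (m : Fin k) :
    P.side m = segment ℝ (P.corners m) (P.corners (finRotate k m)) := affineSegment_eq_segment ..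

theorem side_subset_frontier (P : SimplePolygon k) (m : Fin k) : P.side m ⊆ frontier P.carrier := by
  rw [P.frontier_eq]; exact subset_iUnion (fun i => P.corners.edgeSet ℝ i) m

theorem exists_side_of_mem_frontier (P : SimplePolygon k) {p : Plane}
    (h : p ∈ frontier P.carrier) : ∃ m, p ∈ P.side m := by
  rw [P.frontier_eq] at h; exact mem_iUnion.1 h

theorem frontier_subset (P : SimplePolygon k) : frontier P.carrier ⊆ P.carrier :=
  P.isCompact.isClosed.frontier_subset

theorem corners_ne (P : SimplePolygon k) (m : Fin k) :
    P.corners m ≠ P.corners (finRotate k m) :=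
  P.nondegenerate.hasNondegenerateEdges m

theorem eq_of_mem_side (P : SimplePolygon k) {m m' : Fin k} {p : Plane}
    (hp : p ∈ openSegment ℝ (P.corners m) (P.corners (finRotate k m)))
    (h : p ∈ P.side m') : m' = m := by
  rw [openSegment_eq_image_lineMap] at hp
  obtain ⟨s, hs, rfl⟩ := hp
  obtain ⟨s', hs', he⟩ := h
  rcases hs'.2.lt_or_eq with hlt | rfl
  · have := @P.simple (m', ⟨s', hs'.1, hlt⟩) (m, ⟨s, hs.1.le, hs.2⟩) he
    exact (Prod.ext_iff.1 this).1
  -- The far endpoint of an edge belongs to the next half-open edge, at parameter `0`, which is not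
  -- a parameter in the open interval.
  · have := @P.simple (finRotate k m', ⟨0, le_rfl, zero_lt_one⟩) (m, ⟨s, hs.1.le, hs.2⟩) (by
      rw [AffineMap.lineMap_apply_one] at he
      simpa [Polygon.edgePath] using he)
    have := (Prod.ext_iff.1 this).2
    exact absurd (congrArg Subtype.val this) hs.1.ne

theorem eventually_mem_side (P : SimplePolygon k) {m : Fin k} {c y : Plane}
    (h : P.side m = segment ℝ c (c + y)) :
    ∀ᶠ t : ℝ in 𝓝[>] 0, c + t • y ∈ frontier P.carrier := by
  filter_upwards [Ioo_mem_nhdsGT (zero_lt_one (α := ℝ))] with t ht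
  apply P.side_subset_frontier m
  rw [h, segment_eq_image']
  exact ⟨t, ⟨ht.1.le, ht.2.le⟩, by simp⟩

end SimplePolygon

namespace Dissection

variable {k : ℕ} [NeZero k] {P : SimplePolygon k} {n : ℕ}

/-- Every corner of the polygon is a corner of some triangle. -/
theorem corner_mem_nodes (D : Dissection P n) (m : Fin k) : P.corners m ∈ D.nodes := by
  -- The corner is made the middle one of `i`, `i + 1`, `i + 2`, the triple on which nondegeneracy
  -- is stated; `y` and `z` are then the directions of the two sides at `c`.
  obtain ⟨i, rfl⟩ : ∃ i, i + 1 = m := ⟨m - 1, by simp⟩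
  by_contra hnode
  set c := P.corners (i + 1) with hc
  set y := P.corners (i + 2) - c with hy
  set z := P.corners i - c with hz
  have hyz : cross y z ≠ 0 := by
    have := orient_ne_zero_of_affineIndependent (P.nondegenerate i)
    rw [← orient_rotate] at this
    exact this
  have hfy : ∀ᶠ t : ℝ in 𝓝[>] 0, c + t • y ∈ frontier P.carrier := by
    refine P.eventually_mem_side (m := i + 1) ?_
    rw [P.side_eq, finRotate_apply, hy, add_sub_cancel, Fin.add_one_add_one]
  have hfz : ∀ᶠ t : ℝ in 𝓝[>] 0, c + t • z ∈ frontier P.carrier := by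
    refine P.eventually_mem_side (m := i) ?_
    rw [P.side_eq, finRotate_apply, hz, add_sub_cancel, segment_symm]
  have hcf : c ∈ frontier P.carrier := by
    apply P.side_subset_frontier i
    rw [P.side_eq, finRotate_apply]
    exact right_mem_segment _ _ _
  -- If `c` were not a node, every triangle containing it would be a half plane near `c`.
  have hH : ∀ i, ∃ w : Plane, c ∈ D.triangle i →
      (w ≠ 0 ∧ ∀ᶠ x in 𝓝 c, x ∈ D.triangle i ↔ 0 ≤ cross w (x - c)) := by
    intro i
    by_cases hi : c ∈ D.triangle i
    · obtain ⟨w, hw⟩ := exists_halfPlane_of_mem_triple (D.triOrient_ne_zero i) hi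
        (fun h => hcf.2 (interior_mono (D.triangle_subset i) h))
        (fun h => hnode (h ▸ D.point_mem_nodes i 0)) (fun h => hnode (h ▸ D.point_mem_nodes i 1))
        (fun h => hnode (h ▸ D.point_mem_nodes i 2))
      exact ⟨w, fun _ => hw⟩
    · exact ⟨0, fun h => absurd h hi⟩
  choose w hw using hH
  -- Some half plane touches the frontier ray in direction `y`. The ray cannot enter its interior,
  -- so it runs along its boundary line.
  have hJ : ∀ y : Plane, (∀ᶠ t : ℝ in 𝓝[>] 0, c + t • y ∈ frontier P.carrier) →
      ∃ i, c ∈ D.triangle i ∧ cross (w i) y = 0 := by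
    intro y hy
    obtain ⟨i, hi, hfreq⟩ := D.exists_triangle_of_frequently
      (hy.mono fun t ht => P.frontier_subset ht).frequently
    refine ⟨i, hi, le_antisymm
      (cross_nonpos_of_eventually_frontier (D.triangle_subset i) (hw i hi).2 hy) ?_⟩
    obtain ⟨t, ht, ht1, ht2⟩ := (hfreq.and_eventually
      (((tendsto_add_smul c y).eventually (hw i hi).2).and self_mem_nhdsWithin)).exists
    have := ht1.1 ht
    rw [add_sub_cancel_left, cross_smul_right] at this
    exact nonneg_of_mul_nonneg_right this ht2
  obtain ⟨i1, hi1, hy0⟩ := hJ y hfy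
  obtain ⟨i2, hi2, hz0⟩ := hJ z hfz
  -- Half planes with parallel boundaries would make `y` and `z` parallel; nonparallel ones would
  -- overlap in interior points of two different triangles.
  by_cases hii : i1 = i2
  · subst hii
    exact hyz (cross_eq_zero_trans (hw i1 hi1).1 hy0 hz0)
  · by_cases hww : cross (w i1) (w i2) = 0
    · have h1 : cross y (w i2) = 0 := cross_eq_zero_trans (hw i1 hi1).1 hy0 hww
      rw [cross_swap, neg_eq_zero] at h1
      exact hyz (cross_eq_zero_trans (hw i2 hi2).1 h1 hz0)
    · obtain ⟨x, hx1, hx2⟩ := exists_cross_pos_pos hww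
      obtain ⟨t, h1, h2, h3⟩ := (((tendsto_add_smul c x).eventually
        (eventually_mem_interior_of_halfPlane (hw i1 hi1).2)).and
        (((tendsto_add_smul c x).eventually
        (eventually_mem_interior_of_halfPlane (hw i2 hi2).2)).and self_mem_nhdsWithin)).exists
      rw [add_sub_cancel_left, cross_smul_right] at h1 h2
      exact (Set.disjoint_left.1 (D.disjoint_interior hii)) (h1 (mul_pos h3 hx1))
        (h2 (mul_pos h3 hx2))

end Dissection

/-! ### The two sides of a side of the polygon -/

theorem convex_leftOf (w p : Plane) : Convex ℝ (leftOf w p) := by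
  have : leftOf w p = {x | cross w p < cross w x} := by
    ext x
    simp only [leftOf, mem_ofPred_eq]
    rw [sub_eq_add_neg, cross_add_right, show cross w (-p) = -cross w p by simp [cross]; ring]
    constructor <;> intro h <;> linarith
  rw [this]
  refine convex_halfSpace_gt (IsLinearMap.mk (cross_add_right w) fun r x => ?_) _
  simp [cross_smul_right]

theorem subset_or_disjoint_of_preconnected {U S : Set Plane} (hU : IsPreconnected U)
    (h : ∀ x ∈ U, x ∉ frontier S) : (∀ x ∈ U, x ∈ S) ∨ (∀ x ∈ U, x ∉ S) := by
  have := isPreconnected_iff_subset_of_disjoint.1 hU (interior S) (closure S)ᶜ isOpen_interior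
    isClosed_closure.isOpen_compl
    (fun x hx => by
      by_contra hcon
      simp only [mem_union, mem_compl_iff, not_or, not_not] at hcon
      exact h x hx ⟨hcon.2, hcon.1⟩)
    (by
      ext x
      simp only [mem_inter_iff, mem_compl_iff, mem_empty_iff_false, iff_false, not_and, not_not]
      exact fun _ h => subset_closure (interior_subset h))
  exact this.imp (fun h x hx => interior_subset (h hx)) fun h x hx hS => h hx (subset_closure hS)

theorem exists_ind_eq {U S : Set Plane} (hU : IsPreconnected U)
    (h : ∀ x ∈ U, x ∉ frontier S) : ∃ l, (l = 0 ∨ l = 1) ∧ ∀ x ∈ U, ind (x ∈ S) = l := by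
  rcases subset_or_disjoint_of_preconnected hU h with h | h
  · exact ⟨1, Or.inr rfl, fun x hx => ind_of (h x hx)⟩
  · exact ⟨0, Or.inl rfl, fun x hx => ind_of_not (h x hx)⟩

theorem leftOf_eq_of_cross_eq_zero {w p q : Plane} (h : cross w (q - p) = 0) :
    leftOf w q = leftOf w p := by
  ext x
  have : cross w (x - p) = cross w (x - q) + cross w (q - p) := by
    rw [← cross_add_right, sub_add_sub_cancel]
  simp only [leftOf, mem_ofPred_eq, this, h, add_zero]

theorem mem_closure_leftOf_inter {w x : Plane} (hw : w ≠ 0) {U : Set Plane} (hU : U ∈ 𝓝 x) :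
    (U ∩ leftOf w x).Nonempty := by
  have := leftOf_neBot hw x
  have h := Filter.inter_mem (mem_nhdsWithin_of_mem_nhds (a := x) (t := leftOf w x) hU) self_mem_nhdsWithin
  exact Filter.nonempty_of_mem h

/-- A regular closed set whose frontier near `p` lies on a line lies, near `p`, on exactly one side
of this line, and the jump is the same at all nearby points of the line. -/
theorem exists_hasJump_of_frontier_subset_line {S : Set Plane} (hS : IsClosed S)
    (hreg : S ⊆ closure (interior S)) {w p : Plane} (hw : w ≠ 0) (hp : p ∈ frontier S)
    (h : ∀ᶠ x in 𝓝 p, x ∈ frontier S → cross w (x - p) = 0) :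
    ∃ J : ℤ, (J = 1 ∨ J = -1) ∧
      ∀ᶠ q in 𝓝 p, cross w (q - p) = 0 → HasJump S w q J := by
  obtain ⟨ρ, hρ, hball⟩ := Metric.eventually_nhds_iff_ball.1 h
  set U := Metric.ball p ρ
  have hUo : ∀ x ∈ U, U ∈ 𝓝 x := fun x hx => Metric.isOpen_ball.mem_nhds hx
  have hconn : ∀ w', (∀ x, cross w x = 0 → cross w' x = 0) → ∃ l, (l = 0 ∨ l = 1) ∧
      ∀ x ∈ U ∩ leftOf w' p, ind (x ∈ S) = l := by
    intro w' hw'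
    refine exists_ind_eq ((convex_ball p ρ).inter (convex_leftOf w' p)).isPreconnected ?_
    rintro x ⟨hx, hx'⟩ hf
    exact (ne_of_gt hx') (hw' _ (hball x hx hf))
  obtain ⟨l, hl, hlS⟩ := hconn w fun x hx => hx
  obtain ⟨r, hr, hrS⟩ := hconn (-w) fun x hx => by rw [cross_neg_left, hx, neg_zero]
  refine ⟨l - r, ?_, ?_⟩
  -- If both values were `0`, an interior point of `S` near `p` could be moved off the line, a
  -- contradiction. If both were `1`, closedness would add the line itself and make `p` interior.
  · have hlr : l ≠ r := by
      rintro rfl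
      rcases hl with rfl | rfl
      · obtain ⟨x, hxU, hxS⟩ := mem_closure_iff_nhds.1 (hreg (hS.frontier_subset hp)) U
          (hUo p (Metric.mem_ball_self hρ))
        have hx0 : cross w (x - p) = 0 := by
          by_contra hne
          rcases lt_or_gt_of_ne hne with hlt | hgt
          · have := hrS x ⟨hxU, by simpa [leftOf, cross_neg_left] using hlt⟩
            rw [ind_of (interior_subset hxS)] at this
            exact one_ne_zero this
          · have := hlS x ⟨hxU, hgt⟩
            rw [ind_of (interior_subset hxS)] at this
            exact one_ne_zero this
        obtain ⟨x', ⟨h1, h2⟩, h3⟩ := mem_closure_leftOf_inter hw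
          (Filter.inter_mem (hUo x hxU) (mem_interior_iff_mem_nhds.1 hxS))
        rw [leftOf_eq_of_cross_eq_zero hx0] at h3
        have := hlS x' ⟨h1, h3⟩
        rw [ind_of h2] at this
        exact one_ne_zero this
      · refine hp.2 (mem_interior_iff_mem_nhds.2 (Filter.mem_of_superset
          (hUo p (Metric.mem_ball_self hρ)) fun x hxU => ?_))
        have hone : ∀ y, ind (y ∈ S) = 1 → y ∈ S := fun y hy => by
          by_contra hcon
          rw [ind_of_not hcon] at hy
          exact zero_ne_one hy
        rcases lt_trichotomy (cross w (x - p)) 0 with hlt | heq | hgt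
        · exact hone _ (hrS x ⟨hxU, by simpa [leftOf, cross_neg_left] using hlt⟩)
        · rw [← hS.closure_eq, mem_closure_iff_nhds]
          intro V hV
          obtain ⟨x', ⟨h1, h2⟩, h3⟩ := mem_closure_leftOf_inter hw
            (Filter.inter_mem (hUo x hxU) hV)
          rw [leftOf_eq_of_cross_eq_zero heq] at h3
          exact ⟨x', h2, hone _ (hlS x' ⟨h1, h3⟩)⟩
        · exact hone _ (hlS x ⟨hxU, hgt⟩)
    rcases hl with rfl | rfl <;> rcases hr with rfl | rfl <;> simp_all
  · filter_upwards [Metric.ball_mem_nhds p hρ] with q hq h0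
    refine ⟨l, r, ?_, ?_, rfl⟩
    · rw [leftOf_eq_of_cross_eq_zero h0]
      filter_upwards [mem_nhdsWithin_of_mem_nhds (hUo q hq), self_mem_nhdsWithin] with x h1 h2
      exact hlS x ⟨h1, h2⟩
    · rw [leftOf_eq_of_cross_eq_zero (w := -w) (by rw [cross_neg_left, h0, neg_zero])]
      filter_upwards [mem_nhdsWithin_of_mem_nhds (hUo q hq), self_mem_nhdsWithin] with x h1 h2
      exact hrS x ⟨h1, h2⟩

/-- Near a point of an open side no other side is present, so the local lemma gives a jump of `±1`.
It is locally constant along the connected open side, hence constant. How the signs of different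
sides compare is left open. -/
theorem Dissection.exists_side_jump {k : ℕ} [NeZero k] {P : SimplePolygon k} {n : ℕ}
    (D : Dissection P n) (m : Fin k) :
    ∃ J : ℤ, (J = 1 ∨ J = -1) ∧
      ∀ p ∈ openSegment ℝ (P.corners m) (P.corners (finRotate k m)),
        HasJump P.carrier (P.corners (finRotate k m) - P.corners m) p J := by
  set c := P.corners m with hc
  set d := P.corners (finRotate k m) with hd
  have hw : d - c ≠ 0 := sub_ne_zero.2 (P.corners_ne m).symm
  have hline : ∀ p ∈ openSegment ℝ c d, ∀ q ∈ segment ℝ c d, cross (d - c) (q - p) = 0 := by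
    intro p hp q hq
    rw [← orient_eq_cross_sub (orient_eq_zero_of_mem_segment (openSegment_subset_segment _ _ _ hp))]
    exact orient_eq_zero_of_mem_segment hq
  have hloc : ∀ p ∈ openSegment ℝ c d, ∃ J : ℤ, (J = 1 ∨ J = -1) ∧
      ∀ᶠ q in 𝓝 p, cross (d - c) (q - p) = 0 → HasJump P.carrier (d - c) q J := by
    intro p hp
    refine exists_hasJump_of_frontier_subset_line P.isCompact.isClosed
      D.carrier_subset_closure_interior hw ?_ ?_
    · apply P.side_subset_frontier m
      rw [P.side_eq]
      exact openSegment_subset_segment _ _ _ hp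
    · have : ∀ᶠ x in 𝓝 p, ∀ m', m' ≠ m → x ∉ P.side m' := by
        refine eventually_all.2 fun m' => ?_
        by_cases hm : m' = m
        · simp [hm]
        · have hcl : IsClosed (P.side m') := by
            rw [P.side_eq, ← convexHull_pair]
            exact (Set.toFinite _).isClosed_convexHull ℝ
          filter_upwards [hcl.isOpen_compl.mem_nhds fun h => hm (P.eq_of_mem_side hp h)] with x hx _
          exact hx
      filter_upwards [this] with x hx hxf
      obtain ⟨m', hm'⟩ := P.exists_side_of_mem_frontier hxf
      obtain rfl : m' = m := by
        by_contra hne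
        exact hx m' hne hm'
      rw [P.side_eq] at hm'
      exact hline p hp x hm'
  choose! J hJ1 hJ2 using hloc
  have hself : ∀ p ∈ openSegment ℝ c d, HasJump P.carrier (d - c) p (J p) := fun p hp =>
    (hJ2 p hp).self_of_nhds (by simp [cross])
  have hconst : ∀ p ∈ openSegment ℝ c d, ∀ q ∈ openSegment ℝ c d, J p = J q := by
    intro p hp q hq
    refine (convex_openSegment c d).isPreconnected.induction₂ (fun p q => J p = J q) ?_
      (fun _ _ _ _ _ _ h h' => h.trans h') (fun _ _ _ _ h => h.symm) hp hq
    intro x hx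
    filter_upwards [(hJ2 x hx).filter_mono nhdsWithin_le_nhds, self_mem_nhdsWithin] with y hy hy'
    exact (hy (hline x hx y (openSegment_subset_segment _ _ _ hy'))).unique hw (hself y hy')
  obtain ⟨p0, hp0⟩ : (openSegment ℝ c d).Nonempty := by
    rw [openSegment_eq_image_lineMap]
    exact ⟨_, 1 / 2, by norm_num, rfl⟩
  exact ⟨J p0, hJ1 p0 hp0, fun p hp => hconst p0 hp0 p hp ▸ hself p hp⟩

/-! ### The discrete Stokes formula for a dissection -/

/-- Swapping `u` and `v` cancels the terms in pairs. The diagonal needs `hA0`, since `f u u = -f u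
u` does not give `f u u = 0` in `ZMod 2`. -/
theorem sum_sum_smul_eq_zero {N G : Type*} [Fintype N] [AddCommGroup G] {A : N → N → ℤ}
    {f : N → N → G} (hA : ∀ u v, A u v = A v u) (hA0 : ∀ u, A u u = 0)
    (hf : ∀ u v, f u v = -f v u) : ∑ u, ∑ v, A u v • f u v = 0 := by
  rw [← Fintype.sum_prod_type' (fun u v => A u v • f u v)]
  refine Finset.sum_involution (fun p _ => p.swap) ?_ ?_ (fun _ _ => Finset.mem_univ _) ?_
  · rintro ⟨u, v⟩ -
    simp only [Prod.swap_prod_mk]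
    rw [hA v u, hf v u, smul_neg, add_neg_cancel]
  · rintro ⟨u, v⟩ - h heq
    simp only [Prod.swap_prod_mk, Prod.mk.injEq] at heq
    obtain ⟨rfl, -⟩ := heq
    simp [hA0] at h
  · rintro ⟨u, v⟩ -
    rfl

theorem cross_sub_eq_zero_of_collinear {a b u v x p : Plane} (hab : a ≠ b)
    (hu : orient a b u = 0) (hv : orient a b v = 0) (hp : orient a b p = 0)
    (hx : orient a b x = 0) : cross (v - u) (x - p) = 0 := by
  refine cross_eq_zero_trans (sub_ne_zero.2 hab.symm) ?_ ?_
  · rw [← orient_eq_cross_sub hu, hv]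
  · rw [← orient_eq_cross_sub hp, hx]

namespace Dissection

variable {k : ℕ} [NeZero k] {P : SimplePolygon k} {n : ℕ}

theorem points_ne (D : Dissection P n) (i : Fin n) {j j' : Fin 3} (h : j ≠ j') :
    (D.tri i).points j ≠ (D.tri i).points j' := (D.tri i).independent.injective.ne h

/-- Strictly to the left of the line and close to `p`, no side line is met: those through `p` lie on
the excluded line, the others stay away from `p`. So `x` lies only in interiors of triangles, and
these are disjoint. -/
theorem eventually_ind_eq_sum (D : Dissection P n) {w p : Plane}
    (h : ∀ i, ∀ j j' : Fin 3, j ≠ j' →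
      orient ((D.tri i).points j) ((D.tri i).points j') p = 0 →
      ∀ x, orient ((D.tri i).points j) ((D.tri i).points j') x = 0 → cross w (x - p) = 0) :
    ∀ᶠ x in 𝓝[leftOf w p] p, ind (x ∈ P.carrier) = ∑ i, ind (x ∈ D.triangle i) := by
  have h1 : ∀ i, ∀ j j' : Fin 3, j ≠ j' → ∀ᶠ x in 𝓝[leftOf w p] p,
      orient ((D.tri i).points j) ((D.tri i).points j') x ≠ 0 := by
    intro i j j' hj
    by_cases h0 : orient ((D.tri i).points j) ((D.tri i).points j') p = 0
    · filter_upwards [self_mem_nhdsWithin] with x hx hx0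
      exact (ne_of_gt hx) (h i j j' hj h0 x hx0)
    · refine Filter.Eventually.filter_mono nhdsWithin_le_nhds ?_
      exact (isOpen_ne_fun (by fun_prop) continuous_const).mem_nhds h0
  have h2 : ∀ᶠ x in 𝓝[leftOf w p] p, ∀ i, x ∈ D.triangle i → x ∈ interior (D.triangle i) := by
    refine eventually_all.2 fun i => ?_
    filter_upwards [h1 i 0 1 (by decide), h1 i 1 2 (by decide), h1 i 2 0 (by decide)]
      with x ha hb hc hx
    exact mem_interior_triple (D.triOrient_ne_zero i) hx ha hb hc
  filter_upwards [h2] with x hx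
  by_cases hP : x ∈ P.carrier
  · rw [ind_of hP]
    rw [← D.iUnion_triangle] at hP
    obtain ⟨i, hi⟩ := mem_iUnion.1 hP
    rw [Finset.sum_eq_single i, ind_of hi]
    · intro i' _ hne
      refine ind_of_not fun hi' => ?_
      exact Set.disjoint_left.1 (D.disjoint_interior hne) (hx i' hi') (hx i hi)
    · exact fun h => absurd (Finset.mem_univ _) h
  · rw [ind_of_not hP, Finset.sum_eq_zero]
    exact fun i _ => ind_of_not fun hi => hP (D.triangle_subset i hi)

/-- The signed number of times that the boundaries of the triangles run along `u v`. -/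
def triBoundary (D : Dissection P n) (u v : Plane) : ℤ :=
  ∑ i, (SignType.sign (D.triOrient i) : ℤ) *
    (alongSign ((D.tri i).points 0) ((D.tri i).points 1) u v +
      alongSign ((D.tri i).points 1) ((D.tri i).points 2) u v +
      alongSign ((D.tri i).points 2) ((D.tri i).points 0) u v)

/-- Both sides are the jump of the indicator of `P` across `u v` at a generic point `p`, where every
side line through `p` is the line `u v`. The left side adds the jumps of the triangles, the right
side reads the jump off the frontier of `P`. -/
theorem triBoundary_eq (D : Dissection P n) {δ : Fin k → ℤ}
    (hδ : ∀ m, ∀ p ∈ openSegment ℝ (P.corners m) (P.corners (finRotate k m)),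
      HasJump P.carrier (P.corners (finRotate k m) - P.corners m) p (δ m))
    {u v : D.Node} (huv : Elementary Subtype.val u v) :
    D.triBoundary u v = ∑ m, δ m * alongSign (P.corners m) (P.corners (finRotate k m)) u v := by
  have hne : (u : Plane) ≠ v := Subtype.val_injective.ne huv.1
  have hnode : ∀ q ∈ D.nodes, q ∉ openSegment ℝ (u : Plane) v := fun q hq => huv.2 ⟨q, hq⟩
  obtain ⟨p, hp, hgen⟩ := exists_generic_point (u := (u : Plane)) (v := v)
    (ι := (Fin n × Fin 3 × Fin 3) ⊕ Fin k)
    (Sum.elim (fun i => (D.tri i.1).points i.2.1) fun m => P.corners m)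
    (Sum.elim (fun i => (D.tri i.1).points i.2.2) fun m => P.corners (finRotate k m))
  have hgT : ∀ i j j', orient ((D.tri i).points j) ((D.tri i).points j') p = 0 →
      orient ((D.tri i).points j) ((D.tri i).points j') u = 0 ∧
      orient ((D.tri i).points j) ((D.tri i).points j') v = 0 := fun i j j' =>
    hgen (Sum.inl (i, j, j'))
  have hgP : ∀ m, orient (P.corners m) (P.corners (finRotate k m)) p = 0 →
      orient (P.corners m) (P.corners (finRotate k m)) u = 0 ∧
      orient (P.corners m) (P.corners (finRotate k m)) v = 0 := fun m => hgen (Sum.inr m)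
  have hw : (v : Plane) - u ≠ 0 := sub_ne_zero.2 hne.symm
  have hpar : ∀ i, ∀ j j' : Fin 3, j ≠ j' →
      orient ((D.tri i).points j) ((D.tri i).points j') p = 0 →
      ∀ x, orient ((D.tri i).points j) ((D.tri i).points j') x = 0 →
        cross ((v : Plane) - u) (x - p) = 0 := fun i j j' hj h0 x hx =>
    cross_sub_eq_zero_of_collinear (D.points_ne i hj) (hgT i j j' h0).1 (hgT i j j' h0).2 h0 hx
  have hjump : HasJump P.carrier ((v : Plane) - u) p (D.triBoundary u v) := by
    refine HasJump.sum (T := D.triangle) (fun i => ?_) (D.eventually_ind_eq_sum hpar)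
      (D.eventually_ind_eq_sum fun i j j' hj h0 x hx => by
        rw [cross_neg_left, hpar i j j' hj h0 x hx, neg_zero])
    exact hasJump_triple (D.triOrient_ne_zero i) hne hp (hnode _ (D.point_mem_nodes i 0))
      (hnode _ (D.point_mem_nodes i 1)) (hnode _ (D.point_mem_nodes i 2)) (hgT i 0 1) (hgT i 1 2)
      (hgT i 2 0)
  refine hjump.unique hw ?_
  by_cases hf : p ∈ frontier P.carrier
  · obtain ⟨m, hm⟩ := P.exists_side_of_mem_frontier hf
    have hm' := hm
    rw [P.side_eq] at hm'
    -- Corners of `P` are nodes, and an elementary segment has no node in its relative interior.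
    have hpm : p ∈ openSegment ℝ (P.corners m) (P.corners (finRotate k m)) := by
      refine mem_openSegment_of_ne_left_right ?_ ?_ hm'
      · rintro rfl; exact hnode _ (D.corner_mem_nodes m) hp
      · rintro rfl; exact hnode _ (D.corner_mem_nodes _) hp
    rw [Finset.sum_eq_single m]
    · have h0 := hgP m (orient_eq_zero_of_mem_segment hm')
      exact (hδ m p hpm).along (P.corners_ne m) hne hpm hp (hnode _ (D.corner_mem_nodes m))
        (hnode _ (D.corner_mem_nodes _)) h0.1 h0.2
    · intro m' _ hne'
      rw [alongSign_eq_zero hp, mul_zero]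
      rw [← P.side_eq]
      exact fun h => hne' (P.eq_of_mem_side hpm h)
    · exact fun h => absurd (Finset.mem_univ _) h
  · rw [Finset.sum_eq_zero]
    · exact hasJump_zero_of_notMem_frontier hf
    · intro m _
      rw [alongSign_eq_zero hp, mul_zero]
      rw [← P.side_eq]
      exact fun h => hf (P.side_subset_frontier m h)

/-- The `m`-th corner of the polygon, as a node. -/
def polygonCorner (D : Dissection P n) (m : Fin k) : D.Node := ⟨P.corners m, D.corner_mem_nodes m⟩

/-- The oriented sum of `f` over the boundary of the `i`-th triangle. -/
def boundarySum {G : Type*} [AddCommGroup G] (D : Dissection P n) (f : D.Node → D.Node → G)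
    (i : Fin n) : G :=
  f (D.corner i 0) (D.corner i 1) + f (D.corner i 1) (D.corner i 2) +
    f (D.corner i 2) (D.corner i 0)

-- All values of `f` are expanded over elementary pairs, with coefficients `C` for the triangles and
-- `B` for the sides of `P`.
open Classical in
theorem sum_boundarySum {G : Type*} [AddCommGroup G] (D : Dissection P n) {δ : Fin k → ℤ}
    (hδ : ∀ m, ∀ p ∈ openSegment ℝ (P.corners m) (P.corners (finRotate k m)),
      HasJump P.carrier (P.corners (finRotate k m) - P.corners m) p (δ m))
    (f : D.Node → D.Node → G) (hf : ∀ u v, f u v = -f v u)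
    (hT : ∀ i j j', j ≠ j' → ∀ u ∈ D.nodesOn (D.triSide i j j'), ∀ v ∈ D.nodesOn (D.triSide i j j'),
      ∀ w ∈ D.nodesOn (D.triSide i j j'), f u v + f v w = f u w)
    (hP : ∀ m, ∀ u ∈ D.nodesOn (P.side m), ∀ v ∈ D.nodesOn (P.side m),
      ∀ w ∈ D.nodesOn (P.side m), f u v + f v w = f u w) :
    ∑ i, (SignType.sign (D.triOrient i) : ℤ) • D.boundarySum f i =
      ∑ m, δ m • f (D.polygonCorner m) (D.polygonCorner (finRotate k m)) := by
  have : Fintype D.Node := Fintype.ofFinite _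
  let E : D.Node → D.Node → ℤ := fun u v => if Elementary Subtype.val u v then 1 else 0
  have hval : Function.Injective (Subtype.val : D.Node → Plane) := Subtype.val_injective
  have hsum : ∀ p q : D.Node, p ≠ q →
      (∀ u v w : D.Node, (u : Plane) ∈ segment ℝ (p : Plane) q →
        (v : Plane) ∈ segment ℝ (p : Plane) q → (w : Plane) ∈ segment ℝ (p : Plane) q →
        f u v + f v w = f u w) →
      f p q = ∑ u, ∑ v, (E u v * ind (Along (p : Plane) q u v)) • f u v := by
    intro p q hpq h
    rw [sum_along hval f hpq h]
    refine Finset.sum_congr rfl fun u _ => Finset.sum_congr rfl fun v _ => ?_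
    by_cases hE : Elementary Subtype.val u v <;> simp [E, hE]
  have hside : ∀ i j j', j ≠ j' → f (D.corner i j) (D.corner i j') = ∑ u, ∑ v,
      (E u v * ind (Along ((D.tri i).points j) ((D.tri i).points j') u v)) • f u v := by
    intro i j j' hj
    exact hsum (D.corner i j) (D.corner i j')
      (fun h => D.points_ne i hj (congrArg Subtype.val h))
      fun u v w hu hv hw => hT i j j' hj u hu v hv w hw
  let C : D.Node → D.Node → ℤ := fun u v => E u v * ∑ i, (SignType.sign (D.triOrient i) : ℤ) *
    (ind (Along ((D.tri i).points 0) ((D.tri i).points 1) u v) +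
      ind (Along ((D.tri i).points 1) ((D.tri i).points 2) u v) +
      ind (Along ((D.tri i).points 2) ((D.tri i).points 0) u v))
  let B : D.Node → D.Node → ℤ := fun u v => E u v * ∑ m, δ m *
    ind (Along (P.corners m) (P.corners (finRotate k m)) u v)
  have hC : ∑ i, (SignType.sign (D.triOrient i) : ℤ) • D.boundarySum f i =
      ∑ u, ∑ v, C u v • f u v := by
    have : ∀ i, (SignType.sign (D.triOrient i) : ℤ) • D.boundarySum f i = ∑ u, ∑ v,
        (E u v * ((SignType.sign (D.triOrient i) : ℤ) *
        (ind (Along ((D.tri i).points 0) ((D.tri i).points 1) u v) +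
          ind (Along ((D.tri i).points 1) ((D.tri i).points 2) u v) +
          ind (Along ((D.tri i).points 2) ((D.tri i).points 0) u v)))) • f u v := by
      intro i
      rw [boundarySum, hside i 0 1 (by decide), hside i 1 2 (by decide), hside i 2 0 (by decide)]
      simp only [← Finset.sum_add_distrib, Finset.smul_sum, ← add_smul, smul_smul]
      refine Finset.sum_congr rfl fun u _ => Finset.sum_congr rfl fun v _ => ?_
      congr 1
      ring
    simp only [this, C, Finset.mul_sum, Finset.sum_smul]
    rw [Finset.sum_comm]
    exact Finset.sum_congr rfl fun u _ => Finset.sum_comm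
  have hB : ∑ m, δ m • f (D.polygonCorner m) (D.polygonCorner (finRotate k m)) =
      ∑ u, ∑ v, B u v • f u v := by
    have : ∀ m, δ m • f (D.polygonCorner m) (D.polygonCorner (finRotate k m)) = ∑ u, ∑ v,
        (E u v * (δ m * ind (Along (P.corners m) (P.corners (finRotate k m)) u v))) • f u v := by
      intro m
      rw [hsum (D.polygonCorner m) (D.polygonCorner (finRotate k m))
        (fun h => P.corners_ne m (congrArg Subtype.val h))
        (fun u v w hu hv hw => hP m u (by rw [P.side_eq]; exact hu) v (by rw [P.side_eq]; exact hv)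
          w (by rw [P.side_eq]; exact hw))]
      simp only [Finset.smul_sum, smul_smul]
      refine Finset.sum_congr rfl fun u _ => Finset.sum_congr rfl fun v _ => ?_
      congr 1
      simp only [polygonCorner]
      ring
    simp only [this, B, Finset.mul_sum, Finset.sum_smul]
    rw [Finset.sum_comm]
    exact Finset.sum_congr rfl fun u _ => Finset.sum_comm
  -- The geometry determines only the net number of passages along `u v`, so `C - B` is merely
  -- symmetric; antisymmetry of `f` then makes it contribute nothing.
  have hCB : ∀ u v, C u v - B u v = C v u - B v u := by
    intro u v
    by_cases hE : Elementary Subtype.val u v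
    · have key := D.triBoundary_eq hδ hE
      have e1 : C u v - C v u = D.triBoundary u v := by
        simp only [C, E, if_pos hE, if_pos hE.symm, one_mul, triBoundary, alongSign,
          ← Finset.sum_sub_distrib]
        exact Finset.sum_congr rfl fun i _ => by ring
      have e2 : B u v - B v u =
          ∑ m, δ m * alongSign (P.corners m) (P.corners (finRotate k m)) u v := by
        simp only [B, E, if_pos hE, if_pos hE.symm, one_mul, alongSign,
          ← Finset.sum_sub_distrib]
        exact Finset.sum_congr rfl fun i _ => by ring
      linarith
    · have hE' : ¬ Elementary Subtype.val v u := fun h => hE h.symm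
      simp [C, B, E, hE, hE']
  rw [hC, hB, ← sub_eq_zero]
  simp only [← Finset.sum_sub_distrib, ← sub_smul]
  exact sum_sum_smul_eq_zero hCB (fun u => by simp [C, B, E, Elementary]) hf

end Dissection

/-! ### Areas -/

theorem mem_convexHull_zero_iff {y z : Plane} (hD : cross y z ≠ 0) (s t : ℝ) :
    s • y + t • z ∈ convexHull ℝ {0, y, z} ↔ 0 ≤ s ∧ 0 ≤ t ∧ s + t ≤ 1 := by
  have e0 : orient 0 y z = cross y z := by simp [orient]
  have e1 : orient 0 y (s • y + t • z) = t * cross y z := by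
    simp [orient, cross]; ring
  have e2 : orient y z (s • y + t • z) = (1 - s - t) * cross y z := by
    simp [orient, cross]; ring
  have e3 : orient z 0 (s • y + t • z) = s * cross y z := by
    simp [orient, cross]; ring
  rw [mem_convexHull_triple_iff (by rwa [e0]), e0, e1, e2, e3]
  have hpos : 0 < cross y z * cross y z := mul_self_pos.2 hD
  have key : ∀ r : ℝ, 0 ≤ cross y z * (r * cross y z) ↔ 0 ≤ r := fun r => by
    rw [show cross y z * (r * cross y z) = r * (cross y z * cross y z) by ring,
      mul_nonneg_iff_of_pos_right hpos]
  rw [key, key, key]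
  constructor
  · rintro ⟨h1, h2, h3⟩; exact ⟨h3, h1, by linarith⟩
  · rintro ⟨h1, h2, h3⟩; exact ⟨h2, by linarith, h1⟩

theorem exists_eq_smul_add_smul {y z : Plane} (hD : cross y z ≠ 0) (x : Plane) :
    ∃ s t : ℝ, x = s • y + t • z := by
  refine ⟨cross x z / cross y z, cross y x / cross y z, ?_⟩
  apply Plane.ext_coords <;> simp only [PiLp.add_apply, PiLp.smul_apply, smul_eq_mul] <;>
    field_simp <;> simp only [cross] <;> ring

theorem volume_parallelogram (y z : Plane) :
    volume (parallelepiped ![y, z]) = ENNReal.ofReal |cross y z| := by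
  rw [← (EuclideanSpace.basisFun (Fin 2) ℝ).addHaar_eq_volume, Measure.addHaar_parallelepiped]
  congr 2
  rw [Module.Basis.det_apply, Matrix.det_fin_two]
  simp [Module.Basis.toMatrix_apply, cross]
  ring

/-- The diagonal from `y` to `z` cuts the parallelogram into two halves exchanged by the point
reflection in its center. -/
theorem parallelogram_eq_union {y z : Plane} (hD : cross y z ≠ 0) :
    parallelepiped ![y, z] = convexHull ℝ {0, y, z} ∪
      (fun x => y + z - x) ⁻¹' convexHull ℝ {0, y, z} := by
  ext x
  obtain ⟨s, t, rfl⟩ := exists_eq_smul_add_smul hD x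
  have e : y + z - (s • y + t • z) = (1 - s) • y + (1 - t) • z := by module
  rw [mem_union, mem_preimage, e, mem_convexHull_zero_iff hD, mem_convexHull_zero_iff hD,
    mem_parallelepiped_iff]
  constructor
  · rintro ⟨r, hr, h⟩
    have hr0 := hr.1 0
    have hr0' := hr.2 0
    have hr1 := hr.1 1
    have hr1' := hr.2 1
    simp only [Fin.sum_univ_two, Matrix.cons_val_zero, Matrix.cons_val_one, Pi.zero_apply,
      Pi.one_apply] at *
    have h1 : cross y (s • y + t • z) = cross y (r 0 • y + r 1 • z) := by rw [h]
    have h2 : cross z (s • y + t • z) = cross z (r 0 • y + r 1 • z) := by rw [h]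
    simp only [cross_add_right, cross_smul_right, cross_self_eq_zero, mul_zero, zero_add,
      add_zero] at h1 h2
    rw [cross_swap z y] at h2
    have h1 := mul_right_cancel₀ hD h1
    have h2 := mul_right_cancel₀ (neg_ne_zero.2 hD) h2
    subst h1 h2
    by_cases hle : r 0 + r 1 ≤ 1
    · exact Or.inl ⟨hr0, hr1, hle⟩
    · exact Or.inr ⟨by linarith, by linarith, by linarith⟩
  · intro h
    refine ⟨![s, t], ?_, by simp [Fin.sum_univ_two]⟩
    rw [mem_Icc, Pi.le_def, Pi.le_def]
    simp only [Fin.forall_fin_two, Matrix.cons_val_zero, Matrix.cons_val_one, Pi.zero_apply,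
      Pi.one_apply]
    rcases h with ⟨h1, h2, h3⟩ | ⟨h1, h2, h3⟩ <;>
      refine ⟨⟨?_, ?_⟩, ?_, ?_⟩ <;> linarith

theorem volume_line_eq_zero {y z : Plane} (hD : cross y z ≠ 0) :
    volume {x : Plane | orient y z x = 0} = 0 := by
  have hyz : y ≠ z := by rintro rfl; simp at hD
  refine measure_mono_null ?_ (Measure.addHaar_affineSubspace volume line[ℝ, y, z] ?_)
  · intro x hx
    obtain ⟨t, rfl⟩ := exists_eq_lineMap_of_orient_eq_zero hyz hx
    exact AffineMap.lineMap_mem_affineSpan_pair t y z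
  · intro htop
    -- The line through `y` and `z` misses the origin because the two vectors are independent.
    have h0 : (0 : Plane) ∈ line[ℝ, y, z] := by rw [htop]; trivial
    apply hD
    simpa [orient] using orient_eq_zero_of_collinear (collinear_insert_of_mem_affineSpan_pair h0)

theorem volume_real_convexHull_zero {y z : Plane} (hD : cross y z ≠ 0) :
    volume.real (convexHull ℝ ({0, y, z} : Set Plane)) = |cross y z| / 2 := by
  set T := convexHull ℝ ({0, y, z} : Set Plane) with hT
  have hTm : MeasurableSet T := (isClosed_convexHull_triple _ _ _).measurableSet
  have hrefl : volume ((fun x => y + z - x) ⁻¹' T) = volume T :=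
    (Measure.measurePreserving_sub_left volume (y + z)).measure_preimage hTm.nullMeasurableSet
  have hpre : MeasurableSet ((fun x => y + z - x) ⁻¹' T) :=
    hTm.preimage (by fun_prop)
  have hnull : volume (T ∩ (fun x => y + z - x) ⁻¹' T) = 0 := by
    refine measure_mono_null ?_ (volume_line_eq_zero hD)
    rintro x ⟨h1, h2⟩
    obtain ⟨s, t, rfl⟩ := exists_eq_smul_add_smul hD x
    have e : y + z - (s • y + t • z) = (1 - s) • y + (1 - t) • z := by module
    rw [mem_preimage, e] at h2
    rw [hT, mem_convexHull_zero_iff hD] at h1 h2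
    have : s + t = 1 := by linarith
    have : orient y z (s • y + t • z) = (1 - s - t) * cross y z := by
      simp [orient, cross]; ring
    simp only [mem_ofPred_eq]
    rw [this]
    exact mul_eq_zero_of_left (by linarith) _
  have h := volume_parallelogram y z
  rw [parallelogram_eq_union hD, measure_union₀ hpre.nullMeasurableSet hnull, hrefl] at h
  have hfin : volume T ≠ ⊤ := fun hc => by rw [hc] at h; simp at h
  have := congrArg ENNReal.toReal h
  rw [ENNReal.toReal_add hfin hfin, ENNReal.toReal_ofReal (abs_nonneg _)] at this
  rw [Measure.real]
  linarith

theorem volume_real_convexHull_triple {a b c : Plane} (hD : orient a b c ≠ 0) :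
    volume.real (convexHull ℝ ({a, b, c} : Set Plane)) = |orient a b c| / 2 := by
  have hD' : cross (b - a) (c - a) ≠ 0 := hD
  have : convexHull ℝ ({a, b, c} : Set Plane) =
      (fun x => x + -a) ⁻¹' convexHull ℝ {0, b - a, c - a} := by
    have e : ∀ p q r : Plane, orient (p - a) (q - a) (r + -a) = orient p q r := by
      intro p q r; simp [orient, cross]; ring
    ext x
    rw [mem_preimage, ← sub_self a, mem_convexHull_triple_iff hD, mem_convexHull_triple_iff
      (by rw [sub_eq_add_neg c a, e]; exact hD), e, e, e, sub_eq_add_neg c a, e]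
  rw [this, Measure.real, measure_preimage_add_right, ← Measure.real,
    volume_real_convexHull_zero hD']
  rfl

namespace Dissection

variable {k : ℕ} [NeZero k] {P : SimplePolygon k} {n : ℕ}

/-- Two triangles meet only in their frontiers, which are null because the triangles are convex. -/
theorem volume_real_carrier (D : Dissection P n) :
    volume.real P.carrier = ∑ i, |D.triOrient i| / 2 := by
  rw [← D.iUnion_triangle, measureReal_def, measure_iUnion₀, tsum_fintype, ENNReal.toReal_sum]
  · exact Finset.sum_congr rfl fun i _ => volume_real_convexHull_triple (D.triOrient_ne_zero i)
  · intro i _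
    exact ((Set.toFinite _).isCompact_convexHull (𝕜 := ℝ)).measure_lt_top.ne
  · intro i j hij
    have hfr : ∀ i, volume (frontier (D.triangle i)) = 0 := fun i =>
      (convex_convexHull ℝ _).addHaar_frontier volume
    refine measure_mono_null (t := frontier (D.triangle i) ∪ frontier (D.triangle j)) ?_
      (measure_union_null (hfr i) (hfr j))
    rintro x ⟨hi, hj⟩
    by_contra hcon
    rw [mem_union, not_or, (D.isClosed_triangle i).frontier_eq,
      (D.isClosed_triangle j).frontier_eq, Set.mem_sdiff, Set.mem_sdiff, not_and_not_right,
      not_and_not_right] at hcon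
    exact Set.disjoint_left.1 (D.disjoint_interior hij) (hcon.1 hi) (hcon.2 hj)
  · exact fun i => (D.isClosed_triangle i).measurableSet.nullMeasurableSet

end Dissection

/-! ### Colors -/

section Valuation

variable {v : AbsoluteValue ℝ ℝ}

theorem IsTwoAdic.map_add_le (hv : IsTwoAdic v) (x y : ℝ) : v (x + y) ≤ max (v x) (v y) :=
  hv.nonarch x y

theorem IsTwoAdic.map_add_lt (hv : IsTwoAdic v) {x y r : ℝ} (hx : v x < r) (hy : v y < r) :
    v (x + y) < r := (hv.map_add_le x y).trans_lt (max_lt hx hy)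

theorem IsTwoAdic.map_sub_lt (hv : IsTwoAdic v) {x y r : ℝ} (hx : v x < r) (hy : v y < r) :
    v (x - y) < r := by
  rw [sub_eq_add_neg]; exact hv.map_add_lt hx (by rwa [v.map_neg])

/-- A strictly dominant term survives in a sum: otherwise `x = (x + y) - y` would be smaller than
itself. -/
theorem IsTwoAdic.le_map_add (hv : IsTwoAdic v) {x y : ℝ} (h : v y < v x) :
    v x ≤ v (x + y) := by
  by_contra! hlt
  have := hv.map_sub_lt hlt h
  rw [add_sub_cancel_right] at this
  exact lt_irrefl _ this

theorem IsTwoAdic.map_intCast (hv : IsTwoAdic v) (z : ℤ) : v (z : ℝ) = padicNorm 2 z := by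
  simpa using hv.extends_padicNorm (z : ℚ)

theorem IsTwoAdic.map_intCast_le_one (hv : IsTwoAdic v) (z : ℤ) : v (z : ℝ) ≤ 1 := by
  rw [hv.map_intCast]
  exact_mod_cast padicNorm.of_int (p := 2) z

theorem IsTwoAdic.map_odd (hv : IsTwoAdic v) {z : ℤ} (hz : Odd z) : v (z : ℝ) = 1 := by
  rw [hv.map_intCast]
  have : padicNorm 2 (z : ℚ) = 1 := by
    rw [padicNorm.int_eq_one_iff]
    rw [Nat.cast_ofNat, ← even_iff_two_dvd]
    exact Int.not_even_iff_odd.2 hz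
  exact_mod_cast this

theorem IsTwoAdic.map_two (hv : IsTwoAdic v) : v 2 = 1 / 2 := by
  have := hv.extends_padicNorm 2
  have h2 : padicNorm 2 2 = (2 : ℚ)⁻¹ := by
    have := padicNorm.padicNorm_p_of_prime (p := 2)
    simpa using this
  rw [h2] at this
  simpa using this

theorem color_eq_red {p : Plane} (h : color v p = Color.red) :
    v (p 1) ≤ v (p 0) ∧ 1 ≤ v (p 0) := by
  unfold color at h
  split_ifs at h with h1 h2
  exact ⟨h1 ▸ (le_max_right _ _).trans (le_max_left _ _), h1 ▸ le_max_right _ _⟩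

theorem color_eq_green {p : Plane} (h : color v p = Color.green) :
    v (p 0) < v (p 1) ∧ 1 ≤ v (p 1) := by
  unfold color at h
  split_ifs at h with h1 h2
  refine ⟨lt_of_le_of_ne (h2 ▸ (le_max_left _ _).trans (le_max_left _ _)) fun h => ?_,
    h2 ▸ le_max_right _ _⟩
  exact h1 (h.trans h2)

theorem color_eq_blue {p : Plane} (h : color v p = Color.blue) :
    v (p 0) < 1 ∧ v (p 1) < 1 := by
  unfold color at h
  split_ifs at h with h1 h2
  have hm : max (max (v (p 0)) (v (p 1))) 1 = 1 := by
    rcases max_choice (max (v (p 0)) (v (p 1))) 1 with h | h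
    · rcases max_choice (v (p 0)) (v (p 1)) with h' | h'
      · exact absurd (h'.symm.trans h.symm) h1
      · exact absurd (h'.symm.trans h.symm) h2
    · exact h
  rw [hm] at h1 h2
  have hle := hm.le
  rw [max_le_iff, max_le_iff] at hle
  exact ⟨lt_of_le_of_ne hle.1.1 h1, lt_of_le_of_ne hle.1.2 h2⟩

/-- In the expansion of the determinant the product `a 0 * b 1` has value at least `1` and strictly
dominates the other five. The strict inequalities come from the tie-breaking rule of the coloring.
-/
theorem IsTwoAdic.one_le_orient (hv : IsTwoAdic v) {a b c : Plane} (ha : color v a = Color.red)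
    (hb : color v b = Color.green) (hc : color v c = Color.blue) : 1 ≤ v (orient a b c) := by
  obtain ⟨a1, a2⟩ := color_eq_red ha
  obtain ⟨b1, b2⟩ := color_eq_green hb
  obtain ⟨c1, c2⟩ := color_eq_blue hc
  have e : orient a b c =
      a 0 * b 1 + (b 0 * c 1 - b 1 * c 0 + (c 0 * a 1 - c 1 * a 0) - a 1 * b 0) := by
    simp [orient, cross]; ring
  have hpos : (0 : ℝ) < v (a 0) := zero_lt_one.trans_le a2
  have hpos' : (0 : ℝ) < v (b 1) := zero_lt_one.trans_le b2
  have lt1 : ∀ {x y X Y : ℝ}, v x ≤ X → v y < Y → 0 < X → v (x * y) < X * Y := by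
    intro x y X Y hx hy hX
    rw [v.map_mul]
    exact (mul_le_mul_of_nonneg_right hx (v.nonneg y)).trans_lt (mul_lt_mul_of_pos_left hy hX)
  rw [e]
  refine le_trans ?_ (hv.le_map_add ?_)
  · rw [v.map_mul]; exact one_le_mul_of_one_le_of_one_le a2 b2
  · rw [v.map_mul]
    refine hv.map_sub_lt (hv.map_add_lt (hv.map_sub_lt ?_ ?_) (hv.map_sub_lt ?_ ?_)) ?_
    · rw [mul_comm (b 0), mul_comm (v (a 0)), mul_comm (c 1)]
      exact lt1 b1.le (c2.trans_le a2) hpos'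
    · rw [mul_comm (v (a 0))]
      exact lt1 le_rfl (c1.trans_le a2) hpos'
    · rw [mul_comm]
      exact lt1 a1 (c1.trans_le b2) hpos
    · rw [mul_comm]
      exact lt1 le_rfl (c2.trans_le b2) hpos
    · exact lt1 a1 b1 hpos

theorem map_orient_swap (a b c : Plane) : v (orient b a c) = v (orient a b c) := by
  rw [← v.map_neg]; congr 1; simp [orient, cross]; ring

/-- A permutation of the corners changes `orient` only by a sign, which `v` ignores. -/
theorem IsTwoAdic.one_le_orient_of_rainbow (hv : IsTwoAdic v) {a b c : Plane}
    (hab : color v a ≠ color v b) (hbc : color v b ≠ color v c) (hca : color v c ≠ color v a) :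
    1 ≤ v (orient a b c) := by
  have r1 := orient_rotate a b c
  have r2 := orient_rotate b c a
  rcases ha : color v a <;> rcases hb : color v b <;> rcases hc : color v c <;>
    simp only [ha, hb, hc, ne_eq, not_true_eq_false, reduceCtorEq, not_false_eq_true] at hab hbc hca
  · exact hv.one_le_orient ha hb hc
  · have := hv.one_le_orient ha hc hb
    rwa [← map_orient_swap, r2, r1] at this
  · have := hv.one_le_orient hb ha hc
    rwa [map_orient_swap] at this
  · have := hv.one_le_orient hc ha hb
    rwa [r2, r1] at this
  · have := hv.one_le_orient hb hc ha
    rwa [r1] at this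
  · have := hv.one_le_orient hc hb ha
    rwa [map_orient_swap, r1] at this

end Valuation

/-- The parity of the number of red-blue edges among the single edge with the given colors. -/
def redBlue : Color → Color → ZMod 2
  | Color.red, Color.blue => 1
  | Color.blue, Color.red => 1
  | _, _ => 0

theorem redBlue_symm (a b : Color) : redBlue a b = -redBlue b a := by
  cases a <;> cases b <;> decide

/-- This is the additivity along a side required by the Stokes formula; it needs that at most two
colors occur. -/
theorem redBlue_add {a b c : Color} (h : a = b ∨ b = c ∨ c = a) :
    redBlue a b + redBlue b c = redBlue a c := by
  cases a <;> cases b <;> cases c <;> first | decide | simp at h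

theorem rainbow_of_redBlue_ne_zero {a b c : Color}
    (h : redBlue a b + redBlue b c + redBlue c a ≠ 0) : a ≠ b ∧ b ≠ c ∧ c ≠ a := by
  cases a <;> cases b <;> cases c <;>
    first | exact absurd (by decide) h | exact ⟨by simp, by simp, by simp⟩

/-- Modulo 2 all orientation signs disappear, both of the triangles and of the sides of `P`. -/
theorem zsmul_zmod_two_of_sign {δ : ℤ} (h : δ = 1 ∨ δ = -1) (x : ZMod 2) : δ • x = x := by
  rcases h with rfl | rfl
  · simp
  · simp

theorem odd_sum_signs {ι : Type*} [Fintype ι] (hι : Odd (Fintype.card ι)) {s : ι → ℤ}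
    (hs : ∀ i, s i = 1 ∨ s i = -1) : Odd (∑ i, s i) := by
  rw [← ZMod.intCast_eq_one_iff_odd, Int.cast_sum]
  have : ∀ i, ((s i : ℤ) : ZMod 2) = 1 := fun i => by
    rcases hs i with h | h <;> rw [h] <;> decide
  simp only [this, Finset.sum_const, Finset.card_univ, nsmul_eq_mul, mul_one]
  exact ZMod.natCast_eq_one_iff_odd.2 hι

/-! ### Constrained framed maps -/

namespace Dissection

variable {k : ℕ} [NeZero k] {P : SimplePolygon k} {n : ℕ} {D : Dissection P n}

theorem orient_eq_zero_of_collinear_image {φ : D.Node → Plane} {S : Set D.Node}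
    (h : Collinear ℝ (φ '' S)) {u v w : D.Node} (hu : u ∈ S) (hv : v ∈ S) (hw : w ∈ S) :
    orient (φ u) (φ v) (φ w) = 0 := by
  refine orient_eq_zero_of_collinear (h.subset ?_)
  rintro x (rfl | rfl | rfl)
  · exact mem_image_of_mem φ hu
  · exact mem_image_of_mem φ hv
  · exact mem_image_of_mem φ hw

theorem cross_add_of_collinear_image {φ : D.Node → Plane} {S : Set D.Node}
    (h : Collinear ℝ (φ '' S)) {u v w : D.Node} (hu : u ∈ S) (hv : v ∈ S) (hw : w ∈ S) :
    cross (φ u) (φ v) + cross (φ v) (φ w) = cross (φ u) (φ w) := by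
  have := orient_eq_zero_of_collinear_image h hu hv hw
  rw [orient_eq_cross_add, cross_swap (φ w)] at this
  linarith

/-- The total oriented area of the faces is the same for every constrained framed map. -/
theorem sum_sign_mul_orient (D : Dissection P n) {δ : Fin k → ℤ}
    (hδ : ∀ m, ∀ p ∈ openSegment ℝ (P.corners m) (P.corners (finRotate k m)),
      HasJump P.carrier (P.corners (finRotate k m) - P.corners m) p (δ m))
    {φ : D.Node → Plane} (hφ : D.IsConstrainedFramedMap φ) :
    ∑ i, (SignType.sign (D.triOrient i) : ℤ) *
        orient (φ (D.corner i 0)) (φ (D.corner i 1)) (φ (D.corner i 2)) =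
      ∑ m, δ m * cross (P.corners m) (P.corners (finRotate k m)) := by
  have h := D.sum_boundarySum hδ (fun u v => cross (φ u) (φ v)) (fun _ _ => cross_swap _ _)
    (fun i j j' hj u hu v hv w hw =>
      cross_add_of_collinear_image (hφ.collinear_triSide i j j' hj) hu hv hw)
    (fun m u hu v hv w hw => cross_add_of_collinear_image (hφ.collinear_side m) hu hv hw)
  simp only [boundarySum, zsmul_eq_mul, ← orient_eq_cross_add] at h
  rw [h]
  refine Finset.sum_congr rfl fun m _ => ?_
  rw [hφ.isFramedMap (D.polygonCorner m) m rfl,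
    hφ.isFramedMap (D.polygonCorner (finRotate k m)) (finRotate k m) rfl]

theorem collinear_segment (a b : Plane) : Collinear ℝ (segment ℝ a b) := by
  rw [collinear_iff_exists_forall_eq_smul_vadd]
  refine ⟨a, b - a, fun p hp => ?_⟩
  rw [segment_eq_image_lineMap] at hp
  obtain ⟨t, -, rfl⟩ := hp
  exact ⟨t, rfl⟩

theorem isConstrainedFramedMap_val (D : Dissection P n) :
    D.IsConstrainedFramedMap Subtype.val where
  isFramedMap _ _ h := h
  collinear_triSide _ _ _ _ := (collinear_segment _ _).subset (image_subset_iff.2 fun _ h => h)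
  collinear_side m := by
    refine (collinear_segment (P.corners m) (P.corners (finRotate k m))).subset ?_
    rw [← P.side_eq]
    exact image_subset_iff.2 fun _ h => h

/-- The boundary expression depends only on the corners of `P`, so `φ` can be replaced by the
inclusion, for which every summand is twice the area of its triangle. The signs `δ` never need to be
known. -/
theorem sum_sign_mul_orient_eq_volume (D : Dissection P n) {φ : D.Node → Plane}
    (hφ : D.IsConstrainedFramedMap φ) :
    ∑ i, (SignType.sign (D.triOrient i) : ℤ) *
        orient (φ (D.corner i 0)) (φ (D.corner i 1)) (φ (D.corner i 2)) =
      2 * volume.real P.carrier := by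
  choose δ _ hδ using D.exists_side_jump
  rw [D.sum_sign_mul_orient hδ hφ, ← D.sum_sign_mul_orient hδ D.isConstrainedFramedMap_val,
    D.volume_real_carrier, Finset.mul_sum]
  refine Finset.sum_congr rfl fun i _ => ?_
  have : ((SignType.sign (D.triOrient i) : ℤ) : ℝ) * D.triOrient i = |D.triOrient i| := by
    rw [SignType.intCast_cast]
    exact sign_mul_self _
  rw [mul_div_cancel₀ _ two_ne_zero]
  exact this

theorem sum_redBlue_eq_one {v : AbsoluteValue ℝ ℝ}
    (hRB : Odd (Set.ncard {m : Fin k | P.IsRedBlueSide v m})) :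
    ∑ m, redBlue (color v (P.corners m)) (color v (P.corners (finRotate k m))) = 1 := by
  classical
  have h : ∀ m, redBlue (color v (P.corners m)) (color v (P.corners (finRotate k m))) =
      if P.IsRedBlueSide v m then 1 else 0 := by
    intro m
    unfold SimplePolygon.IsRedBlueSide
    cases color v (P.corners m) <;> cases color v (P.corners (finRotate k m)) <;> simp [redBlue]
  simp only [h, Finset.sum_boole]
  rw [ZMod.natCast_eq_one_iff_odd]
  convert hRB
  rw [Set.ncard_eq_toFinset_card']
  congr 1
  ext
  simp

/-- The image of some face has corners of all three colors. -/
theorem exists_rainbow_face {v : AbsoluteValue ℝ ℝ} (hv : IsTwoAdic v)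
    (hRB : Odd (Set.ncard {m : Fin k | P.IsRedBlueSide v m})) (D : Dissection P n)
    {φ : D.Node → Plane} (hφ : D.IsConstrainedFramedMap φ) :
    ∃ i, color v (φ (D.corner i 0)) ≠ color v (φ (D.corner i 1)) ∧
      color v (φ (D.corner i 1)) ≠ color v (φ (D.corner i 2)) ∧
      color v (φ (D.corner i 2)) ≠ color v (φ (D.corner i 0)) := by
  choose δ hδ1 hδ using D.exists_side_jump
  have hadd : ∀ S : Set D.Node, Collinear ℝ (φ '' S) → ∀ a ∈ S, ∀ b ∈ S, ∀ c ∈ S,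
      redBlue (color v (φ a)) (color v (φ b)) + redBlue (color v (φ b)) (color v (φ c)) =
        redBlue (color v (φ a)) (color v (φ c)) := by
    intro S hS a ha b hb c hc
    refine redBlue_add ?_
    by_contra! h
    -- Three differently colored collinear points would give `v 0 ≥ 1`.
    have := hv.one_le_orient_of_rainbow h.1 h.2.1 h.2.2
    rw [orient_eq_zero_of_collinear_image hS ha hb hc, v.map_zero] at this
    exact not_lt_of_ge this zero_lt_one
  have h := D.sum_boundarySum hδ (fun a b => redBlue (color v (φ a)) (color v (φ b)))
    (fun _ _ => redBlue_symm _ _)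
    (fun i j j' hj => hadd _ (hφ.collinear_triSide i j j' hj))
    (fun m => hadd _ (hφ.collinear_side m))
  have hcorner : ∀ m, φ (D.polygonCorner m) = P.corners m := fun m =>
    hφ.isFramedMap _ m rfl
  simp only [zsmul_zmod_two_of_sign (hδ1 _), hcorner, sum_redBlue_eq_one hRB] at h
  obtain ⟨i, -, hi⟩ := Finset.exists_ne_zero_of_sum_ne_zero (h.trans_ne one_ne_zero)
  exact ⟨i, rainbow_of_redBlue_ne_zero (right_ne_zero_of_smul hi)⟩

end Dissection

end

/-! ### The 2-adic contradiction -/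

theorem corollary3p11 (v : AbsoluteValue ℝ ℝ) (hv : IsTwoAdic v)
    {k : ℕ} [NeZero k] (P : SimplePolygon k)
    (E : ℤ) (hE : volume.real P.carrier = (E : ℝ))
    (hRB : Odd (Set.ncard {m : Fin k | P.IsRedBlueSide v m}))
    {n : ℕ} (hn : Odd n) (D : Dissection P n)
    (φ : D.Node → Plane) (hφ : D.IsConstrainedFramedMap φ) :
    ¬ ∃ α : ℝ, ∀ i : Fin n, D.unsignedArea φ i = α := by
  rintro ⟨α, hα⟩
  obtain ⟨i, h1, h2, h3⟩ := D.exists_rainbow_face hv hRB hφ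
  have harea : ∀ i, |orient (φ (D.corner i 0)) (φ (D.corner i 1)) (φ (D.corner i 2))| = 2 * α := by
    intro i
    rw [← hα i, Dissection.unsignedArea, signedArea_eq_orient, abs_div, abs_two]
    ring
  -- The sign `s` combines the orientation of the original triangle with that of its image. It is
  -- chosen to be `±1` even if `α = 0`, so that the parity of the sum depends only on `n`.
  have hsign : ∀ i, ∃ s : ℤ, (s = 1 ∨ s = -1) ∧ (SignType.sign (D.triOrient i) : ℤ) *
      orient (φ (D.corner i 0)) (φ (D.corner i 1)) (φ (D.corner i 2)) = s * (2 * α) := by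
    intro i
    rw [← harea i]
    rcases lt_or_gt_of_ne (D.triOrient_ne_zero i) with h | h <;>
      rcases abs_choice (orient (φ (D.corner i 0)) (φ (D.corner i 1)) (φ (D.corner i 2)))
        with h' | h' <;> rw [h']
    · exact ⟨-1, by simp, by simp [sign_neg h]⟩
    · exact ⟨1, by simp, by simp [sign_neg h]⟩
    · exact ⟨1, by simp, by simp [sign_pos h]⟩
    · exact ⟨-1, by simp, by simp [sign_pos h]⟩
  choose s hs1 hs2 using hsign
  have hodd : Odd (∑ i, s i) := odd_sum_signs (by rwa [Fintype.card_fin]) hs1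
  have hsum := D.sum_sign_mul_orient_eq_volume hφ
  simp only [hs2, ← Finset.sum_mul] at hsum
  rw [hE] at hsum
  have hE' : ((∑ i, s i : ℤ) : ℝ) * α = E := by
    push_cast
    linarith
  -- The odd factor has value `1`, so `α` inherits the bound of the integer `E`.
  have hvα : v α ≤ 1 := by
    have := congrArg v hE'
    rw [v.map_mul, hv.map_odd hodd, one_mul] at this
    rw [this]
    exact hv.map_intCast_le_one E
  have hlarge := hv.one_le_orient_of_rainbow h1 h2 h3
  have habs : v (2 * α) =
      v (orient (φ (D.corner i 0)) (φ (D.corner i 1)) (φ (D.corner i 2))) := by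
    rw [← harea i]
    rcases abs_choice (orient (φ (D.corner i 0)) (φ (D.corner i 1)) (φ (D.corner i 2)))
      with h' | h' <;> rw [h']
    exact v.map_neg _
  -- The rainbow face now requires `1 ≤ 1 / 2 * v α`, against `v α ≤ 1`.
  rw [← habs, v.map_mul, hv.map_two] at hlarge
  linarith
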